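/- **Model.** $K$ sources send to $K$ destinations through a relay with $M=M_0+M_1\ge 1$ receive and $M$ transmit antennas; $M_0$ of each have ideal converters, $M_1$ have low-resolution ADCs/DACs with distortion factor $\rho\in[0,1)$ and gain $\alpha=1-\rho$. Let $p_{S,i}\ge 0$, $p_R\ge 0$, $\beta_{SR,i},\beta_{RD,i}>0$. The channel matrices $G_{SR},G_{RD}\in\mathbb C^{M\times K}$ (with columns $g_{SR,k},g_{RD,k}$) have entries of law $\mathcal{CN}(0,\beta_{SR,k})$, $\mathcal{CN}(0,\beta_{RD,k})$ in column $k$; the symbols $x_S\in\mathbb C^K$ and the noises $n_R\in\mathbb C^M$, $n_D\in\mathbb C^K$ have $\mathcal{CN}(0,1)$ entries; all these entries are mutually independent. A subscript $0$ (resp. $1$) denotes the first $M_0$ (resp. last $M_1$) rows. The relay receives $y_R=G_{SR}\,\mathrm{diag}(p_{S,i})^{1/2}x_S+n_R$, quantizes it to $\tilde y_R=(y_{R0},\ \alpha y_{R1}+n_{q_a})$, forms $x_R=W\tilde y_R$ with $W=G_{RD}^*G_{SR}^H$ (maximum ratio processing), and transmits $\gamma\tilde x_R$ with $\tilde x_R=(x_{R0},\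 \alpha x_{R1}+n_{q_D})$ and $\gamma=\sqrt{p_R/\mathbb E\|\tilde x_R\|^2}$. The destinations receive $y_D=\gamma G_{RD}^T\tilde x_R+n_D$. The quantization noises follow the additive quantization noise model: they have finite second moments and, conditionally on the channels, $n_{q_a}$ and $n_{q_D}$ have mean zero and covariance matrices $\alpha\rho\,\mathrm{diag}(R_{y_{R1}})$ and $\alpha\rho\,\mathrm{diag}(R_{x_{R1}})$, where $R_{y_{R1}},R_{x_{R1}}$ are the conditional covariance matrices of $y_{R1},x_{R1}$ and $\mathrm{diag}$ keeps the diagonal part only; both are conditionally uncorrelated with $x_S,n_R,n_D$ and with each other. **Rate.** Let $\Lambda=\mathrm{diag}(1,\dots,1,\alpha,\dots,\alpha)$ ($M_0$ ones, $M_1$ entries $\alpha$), and let $T_{k,k}=\gamma\, g_{RD,k}^T\Lambda W\Lambda\, g_{SR,k}$ be the end-to-end channel of pair $k$. Destination $k$ knows the channel statistics only, so the desired signal is $s_k=\sqrt{p_{S,k}}\,\mathbb E\{T_{k,k}\}\,x_{S,k}$ and the effective noise is $\tilde n_{D,k}=y_{D,k}-s_k$. With coherence interval $\tau_c>0$ and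 pilot length $\tau_p$, the achievable rate given by the corresponding capacity bound is $$R_k=\frac{\tau_c-2\tau_p}{2\tau_c}\log_2\!\Big(1+\frac{\mathbb E|s_k|^2}{\mathbb E|\tilde n_{D,k}|^2}\Big).$$ **Theorem 1.** For every $k$, $s_k$ and $\tilde n_{D,k}$ have finite power and are uncorrelated, and $$R_k=\frac{\tau_c-2\tau_p}{2\tau_c}\log_2\!\Big(1+\frac{A_k}{B_k+C_k+D_k+E_k+F_k+G_k+1}\Big),$$ where, with $N_1=M_0+\alpha M_1$, $N_2=M_0+\alpha^2M_1$, $\sigma=\sum_m\beta_{SR,m}\beta_{RD,m}$, $\pi=\sum_i p_{S,i}\beta_{SR,i}$, - $A_k=p_{S,k}\gamma^2N_1^4\beta_{SR,k}^2\beta_{RD,k}^2$, - $B_k=p_{S,k}\gamma^2N_2\,\beta_{SR,k}\beta_{RD,k}\big[2N_1^2\beta_{SR,k}\beta_{RD,k}+N_2\sigma\big]$, - $C_k=\gamma^2N_2\sum_{i\ne k}p_{S,i}\big[N_1^2(\beta_{SR,k}\beta_{RD,k}^2\beta_{SR,i}+\beta_{RD,k}\beta_{SR,i}^2\beta_{RD,i})+N_2\beta_{RD,k}\beta_{SR,i}\sigma\big]$,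 - $D_k=\gamma^2M_0N_1^2\beta_{SR,k}\beta_{RD,k}^2+\gamma^2M_0N_2\beta_{RD,k}\sigma$, - $E_k=\gamma^2\alpha^2M_1N_1^2\beta_{SR,k}\beta_{RD,k}^2+\gamma^2\alpha^2M_1N_2\beta_{RD,k}\sigma$, - $F_k=\alpha\rho\gamma^2M_1\beta_{RD,k}\big\{N_2\sum_m\beta_{SR,m}\beta_{RD,m}(\pi+p_{S,m}\beta_{SR,m}+1)+N_1^2\beta_{SR,k}\beta_{RD,k}(\pi+p_{S,k}\beta_{SR,k}+1)\big\}$, - $G_k=\alpha\rho\gamma^2M_1N_1\beta_{RD,k}\big\{\beta_{SR,k}\beta_{RD,k}(\pi+1+N_1p_{S,k}\beta_{SR,k})+\sum_m\beta_{SR,m}\beta_{RD,m}(\pi+1+N_1p_{S,m}\beta_{SR,m})\big\}+\alpha^2\rho^2\gamma^2M_1^2\beta_{RD,k}\big(\sum_ip_{S,i}\beta_{SR,i}^2\beta_{RD,i}+p_{S,k}\beta_{SR,k}^2\beta_{RD,k}\big)$. Moreover $\mathbb E\|\gamma\tilde x_R\|^2=p_R$ and $\gamma=\sqrt{p_R/(\mu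 N_1)}$ with $\mu=N_1\sum_m\beta_{SR,m}\beta_{RD,m}(\pi+1+N_1p_{S,m}\beta_{SR,m})+\alpha\rho M_1\sum_mp_{S,m}\beta_{SR,m}^2\beta_{RD,m}$. -/

import Mathlib

open MeasureTheory ProbabilityTheory
open scoped Matrix

noncomputable section

/-- The circularly symmetric complex Gaussian law `CN(0, v)`: independent real and imaginary
parts, each of law `N(0, v / 2)`. -/
def complexGaussian (v : ℝ) : Measure ℂ :=
  ((gaussianReal 0 (v / 2).toNNReal).prod (gaussianReal 0 (v / 2).toNNReal)).map
    (fun z : ℝ × ℝ => (⟨z.1, z.2⟩ : ℂ))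

/-- The relay antennas: `M₀` with high-resolution converters, then `M₁` with low-resolution
ones. -/
abbrev Antenna (M₀ M₁ : ℕ) : Type := Fin M₀ ⊕ Fin M₁

/-- The deterministic parameters of a system with `K` user pairs. -/
structure RelayParams (K : ℕ) where
  /-- transmit powers of the sources -/
  pS : Fin K → ℝ
  /-- total transmit power of the relay -/
  pR : ℝ
  /-- large-scale fading coefficients, sources to relay -/
  βSR : Fin K → ℝ
  /-- large-scale fading coefficients, relay to destinations -/
  βRD : Fin K → ℝ
  /-- distortion factor of the low-resolution ADCs and DACs -/
  ρ : ℝ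
  /-- length of the coherence interval, in symbols -/
  τc : ℕ
  /-- length of the pilot sequences, in symbols -/
  τp : ℕ
  pS_nonneg : ∀ i, 0 ≤ pS i
  pR_nonneg : 0 ≤ pR
  βSR_pos : ∀ i, 0 < βSR i
  βRD_pos : ∀ i, 0 < βRD i
  ρ_nonneg : 0 ≤ ρ
  ρ_lt_one : ρ < 1
  τc_pos : 0 < τc

/-- The linear gain of the low-resolution converters, `α = 1 - ρ`. -/
def RelayParams.α {K : ℕ} (P : RelayParams K) : ℝ := 1 - P.ρ

/-- The primitive random quantities: the channels, the source symbols, the thermal noise at the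
relay and at the destinations, and the quantization noise of the low-resolution ADCs and DACs. -/
structure RelaySignals (Ω : Type*) (K M₀ M₁ : ℕ) where
  GSR : Ω → Matrix (Antenna M₀ M₁) (Fin K) ℂ
  GRD : Ω → Matrix (Antenna M₀ M₁) (Fin K) ℂ
  xS : Ω → Fin K → ℂ
  nR : Ω → Antenna M₀ M₁ → ℂ
  nD : Ω → Fin K → ℂ
  nqA : Ω → Fin M₁ → ℂ
  nqD : Ω → Fin M₁ → ℂ

namespace RelaySignals

variable {Ω : Type*} {K M₀ M₁ : ℕ}

/-- Signal received by the relay, `y_R = G_SR P_S^(1/2) x_S + n_R`. -/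
def yR (X : RelaySignals Ω K M₀ M₁) (P : RelayParams K) (ω : Ω) : Antenna M₀ M₁ → ℂ :=
  X.GSR ω *ᵥ (fun i => (Real.sqrt (P.pS i) : ℂ) * X.xS ω i) + X.nR ω

/-- Output of the mixed ADCs: the high-resolution ones are transparent, a low-resolution one
returns `α` times its input plus quantization noise. -/
def yRq (X : RelaySignals Ω K M₀ M₁) (P : RelayParams K) (ω : Ω) : Antenna M₀ M₁ → ℂ :=
  Sum.elim (fun a => X.yR P ω (Sum.inl a))
    (fun a => (P.α : ℂ) * X.yR P ω (Sum.inr a) + X.nqA ω a)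

/-- The maximum ratio processing matrix `W = G_RD^* G_SR^H`. -/
def W (X : RelaySignals Ω K M₀ M₁) (ω : Ω) : Matrix (Antenna M₀ M₁) (Antenna M₀ M₁) ℂ :=
  (X.GRD ω).map star * (X.GSR ω)ᴴ

/-- The amplify-and-forward signal `x_R = W ỹ_R`. -/
def xR (X : RelaySignals Ω K M₀ M₁) (P : RelayParams K) (ω : Ω) : Antenna M₀ M₁ → ℂ :=
  X.W ω *ᵥ X.yRq P ω

/-- Output of the mixed DACs. -/
def xRq (X : RelaySignals Ω K M₀ M₁) (P : RelayParams K) (ω : Ω) : Antenna M₀ M₁ → ℂ :=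
  Sum.elim (fun a => X.xR P ω (Sum.inl a))
    (fun a => (P.α : ℂ) * X.xR P ω (Sum.inr a) + X.nqD ω a)

/-- The sigma-algebra generated by the two channel matrices. -/
@[reducible]
def channelSigma (X : RelaySignals Ω K M₀ M₁) : MeasurableSpace Ω :=
  MeasurableSpace.comap
    (fun ω (s : (Antenna M₀ M₁ × Fin K) ⊕ (Antenna M₀ M₁ × Fin K)) =>
      Sum.elim (fun q => X.GSR ω q.1 q.2) (fun q => X.GRD ω q.1 q.2) s)
    MeasurableSpace.pi

/-- Labels of the mutually independent Gaussian inputs: entries of `G_SR`, entries of `G_RD`,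
entries of `x_S`, of `n_R` and of `n_D`. -/
abbrev Label (K M₀ M₁ : ℕ) : Type :=
  (Antenna M₀ M₁ × Fin K) ⊕ (Antenna M₀ M₁ × Fin K) ⊕ Fin K ⊕ Antenna M₀ M₁ ⊕ Fin K

/-- The family of all mutually independent Gaussian inputs. -/
def gaussianInput (X : RelaySignals Ω K M₀ M₁) : Label K M₀ M₁ → Ω → ℂ
  | Sum.inl q => fun ω => X.GSR ω q.1 q.2
  | Sum.inr (Sum.inl q) => fun ω => X.GRD ω q.1 q.2
  | Sum.inr (Sum.inr (Sum.inl i)) => fun ω => X.xS ω i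
  | Sum.inr (Sum.inr (Sum.inr (Sum.inl a))) => fun ω => X.nR ω a
  | Sum.inr (Sum.inr (Sum.inr (Sum.inr i))) => fun ω => X.nD ω i

end RelaySignals

/-- Their variances: `β_SR,k` and `β_RD,k` for the channels, one for symbols and noise. -/
def RelayParams.inputVariance {K : ℕ} (P : RelayParams K) (M₀ M₁ : ℕ) :
    RelaySignals.Label K M₀ M₁ → ℝ
  | Sum.inl q => P.βSR q.2
  | Sum.inr (Sum.inl q) => P.βRD q.2
  | Sum.inr (Sum.inr _) => 1

/-- `noise` is the quantization noise of a bank of converters with distortion factor `ρ` and input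
`input` under the additive quantization noise model, for known channels (sigma-algebra `𝒢`): it has
conditional mean zero, it is conditionally uncorrelated with the signals `others` (the input is
a combination of these with `𝒢`-measurable coefficients), and its conditional covariance matrix
is `α ρ diag(R)`, where `α = 1 - ρ` and `R` is the conditional covariance matrix of the input. -/
structure IsQuantizationNoise {Ω : Type*} (𝒢 : MeasurableSpace Ω) [mΩ : MeasurableSpace Ω]
    (μ : Measure Ω) (ρ : ℝ) {n ι : Type*} (input noise : Ω → n → ℂ) (others : Ω → ι → ℂ) :
    Prop where
  memLp : ∀ a, MemLp (fun ω => noise ω a) 2 μ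
  mean_zero : ∀ a, μ[fun ω => noise ω a | 𝒢] =ᵐ[μ] 0
  uncorrelated : ∀ a i, μ[fun ω => noise ω a * star (others ω i) | 𝒢] =ᵐ[μ] 0
  cov_diag : ∀ a, μ[fun ω => noise ω a * star (noise ω a) | 𝒢] =ᵐ[μ]
    fun ω => ((1 - ρ) * ρ : ℂ) * μ[fun ω' => input ω' a * star (input ω' a) | 𝒢] ω
  cov_offdiag : ∀ a b, a ≠ b → μ[fun ω => noise ω a * star (noise ω b) | 𝒢] =ᵐ[μ] 0

/-- The probabilistic model of the system. -/
structure IsRelayModel {Ω : Type*} [MeasurableSpace Ω] (μ : Measure Ω) {K M₀ M₁ : ℕ}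
    (P : RelayParams K) (X : RelaySignals Ω K M₀ M₁) : Prop where
  measurable_input : ∀ s, Measurable (X.gaussianInput s)
  map_input : ∀ s, μ.map (X.gaussianInput s) = complexGaussian (P.inputVariance M₀ M₁ s)
  indep_input : iIndepFun X.gaussianInput μ
  /-- quantization noise of the low-resolution ADCs, whose input is `y_R1` -/
  adc : IsQuantizationNoise X.channelSigma μ P.ρ
    (fun ω a => X.yR P ω (Sum.inr a)) X.nqA
    (fun ω => Sum.elim (X.xS ω) (Sum.elim (X.nR ω) (X.nD ω)))
  /-- quantization noise of the low-resolution DACs, whose input is `x_R1` -/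
  dac : IsQuantizationNoise X.channelSigma μ P.ρ
    (fun ω a => X.xR P ω (Sum.inr a)) X.nqD
    (fun ω => Sum.elim (X.xS ω) (Sum.elim (X.nR ω) (Sum.elim (X.nD ω) (X.nqA ω))))

namespace RelaySignals

variable {Ω : Type*} [MeasurableSpace Ω] {K M₀ M₁ : ℕ}

/-- The normalization factor `γ = (p_R / E ‖x̃_R‖²)^(1/2)`. -/
def γ (X : RelaySignals Ω K M₀ M₁) (P : RelayParams K) (μ : Measure Ω) : ℝ :=
  Real.sqrt (P.pR / ∫ ω, ∑ a, ‖X.xRq P ω a‖ ^ 2 ∂μ)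

/-- Signal received by destination `k`, the `k`-th entry of `y_D = γ G_RD^T x̃_R + n_D`. -/
def yD (X : RelaySignals Ω K M₀ M₁) (P : RelayParams K) (μ : Measure Ω) (k : Fin K) (ω : Ω) : ℂ :=
  (X.γ P μ : ℂ) * ((X.GRD ω)ᵀ *ᵥ X.xRq P ω) k + X.nD ω k

/-- The end-to-end channel from source `j` to destination `i`,
`T_ij = γ g_RD,i^T Λ G_RD^* G_SR^H Λ g_SR,j` with `Λ = diag(1, …, 1, α, …, α)`. -/
def T (X : RelaySignals Ω K M₀ M₁) (P : RelayParams K) (μ : Measure Ω) (i j : Fin K) (ω : Ω) : ℂ :=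
  let Λ : Matrix (Antenna M₀ M₁) (Antenna M₀ M₁) ℂ :=
    Matrix.diagonal (Sum.elim (fun _ => 1) (fun _ => (P.α : ℂ)))
  (X.γ P μ : ℂ) * ((X.GRD ω)ᵀ * Λ * X.W ω * Λ * X.GSR ω) i j

/-- The desired signal at destination `k`, which knows the channel statistics only:
`p_S,k^(1/2) E{T_kk} x_S,k`. -/
def desired (X : RelaySignals Ω K M₀ M₁) (P : RelayParams K) (μ : Measure Ω) (k : Fin K)
    (ω : Ω) : ℂ :=
  (Real.sqrt (P.pS k) : ℂ) * (∫ ω', X.T P μ k k ω' ∂μ) * X.xS ω k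

/-- The effective noise at destination `k`: all the rest of the received signal. -/
def effNoise (X : RelaySignals Ω K M₀ M₁) (P : RelayParams K) (μ : Measure Ω) (k : Fin K)
    (ω : Ω) : ℂ :=
  X.yD P μ k ω - X.desired P μ k ω

/-- The achievable rate of destination `k` given by the capacity bound for statistical channel
knowledge: the prelog factor times `log₂(1 + SINR)`, the `SINR` being the power of the desired
signal over the power of the effective noise. -/
def rate (X : RelaySignals Ω K M₀ M₁) (P : RelayParams K) (μ : Measure Ω) (k : Fin K) : ℝ :=
  ((P.τc : ℝ) - 2 * P.τp) / (2 * P.τc) *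
    Real.logb 2 (1 + (∫ ω, ‖X.desired P μ k ω‖ ^ 2 ∂μ) / ∫ ω, ‖X.effNoise P μ k ω‖ ^ 2 ∂μ)

end RelaySignals

namespace RelayParams

variable {K : ℕ}

/-- `M₀ + α M₁` -/
def N₁ (P : RelayParams K) (M₀ M₁ : ℕ) : ℝ := M₀ + P.α * M₁

/-- `M₀ + α² M₁` -/
def N₂ (P : RelayParams K) (M₀ M₁ : ℕ) : ℝ := M₀ + P.α ^ 2 * M₁

/-- `∑ₘ β_SR,m β_RD,m` -/
def sumββ (P : RelayParams K) : ℝ := ∑ m, P.βSR m * P.βRD m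

/-- `∑ᵢ p_S,i β_SR,i` -/
def sumpβ (P : RelayParams K) : ℝ := ∑ i, P.pS i * P.βSR i

/-- The mean power `μ` of each entry of the signal `x_R` at the relay. -/
def entryPower (P : RelayParams K) (M₀ M₁ : ℕ) : ℝ :=
  P.N₁ M₀ M₁ * ∑ m, P.βSR m * P.βRD m * (P.sumpβ + 1 + P.N₁ M₀ M₁ * P.pS m * P.βSR m) +
    P.α * P.ρ * M₁ * ∑ m, P.pS m * P.βSR m ^ 2 * P.βRD m

/-- The desired signal term `A_k`. -/
def termA (P : RelayParams K) (M₀ M₁ : ℕ) (γ : ℝ) (k : Fin K) : ℝ :=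
  P.pS k * γ ^ 2 * P.N₁ M₀ M₁ ^ 4 * P.βSR k ^ 2 * P.βRD k ^ 2

/-- The estimation error term `B_k`. -/
def termB (P : RelayParams K) (M₀ M₁ : ℕ) (γ : ℝ) (k : Fin K) : ℝ :=
  P.pS k * γ ^ 2 * P.N₂ M₀ M₁ * P.βSR k * P.βRD k *
    (2 * P.N₁ M₀ M₁ ^ 2 * P.βSR k * P.βRD k + P.N₂ M₀ M₁ * P.sumββ)

/-- The inter-pair interference term `C_k`. -/
def termC (P : RelayParams K) (M₀ M₁ : ℕ) (γ : ℝ) (k : Fin K) : ℝ :=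
  γ ^ 2 * P.N₂ M₀ M₁ * ∑ i ∈ Finset.univ.erase k, P.pS i *
    (P.N₁ M₀ M₁ ^ 2 *
        (P.βSR k * P.βRD k ^ 2 * P.βSR i + P.βRD k * P.βSR i ^ 2 * P.βRD i) +
      P.N₂ M₀ M₁ * P.βRD k * P.βSR i * P.sumββ)

/-- The term `D_k` of the noise received on the high-resolution antennas. -/
def termD (P : RelayParams K) (M₀ M₁ : ℕ) (γ : ℝ) (k : Fin K) : ℝ :=
  γ ^ 2 * M₀ * P.N₁ M₀ M₁ ^ 2 * P.βSR k * P.βRD k ^ 2 +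
    γ ^ 2 * M₀ * P.N₂ M₀ M₁ * P.βRD k * P.sumββ

/-- The term `E_k` of the noise received on the low-resolution antennas. -/
def termE (P : RelayParams K) (M₀ M₁ : ℕ) (γ : ℝ) (k : Fin K) : ℝ :=
  γ ^ 2 * P.α ^ 2 * M₁ * P.N₁ M₀ M₁ ^ 2 * P.βSR k * P.βRD k ^ 2 +
    γ ^ 2 * P.α ^ 2 * M₁ * P.N₂ M₀ M₁ * P.βRD k * P.sumββ

/-- The term `F_k` of the quantization noise of the ADCs. -/
def termF (P : RelayParams K) (M₀ M₁ : ℕ) (γ : ℝ) (k : Fin K) : ℝ :=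
  P.α * P.ρ * γ ^ 2 * M₁ * P.βRD k *
    (P.N₂ M₀ M₁ * ∑ m, P.βSR m * P.βRD m * (P.sumpβ + P.pS m * P.βSR m + 1) +
      P.N₁ M₀ M₁ ^ 2 * P.βSR k * P.βRD k * (P.sumpβ + P.pS k * P.βSR k + 1))

/-- The term `G_k` of the quantization noise of the DACs. -/
def termG (P : RelayParams K) (M₀ M₁ : ℕ) (γ : ℝ) (k : Fin K) : ℝ :=
  P.α * P.ρ * γ ^ 2 * M₁ * P.N₁ M₀ M₁ * P.βRD k *
      (P.βSR k * P.βRD k * (P.sumpβ + 1 + P.N₁ M₀ M₁ * P.pS k * P.βSR k) +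
        ∑ m, P.βSR m * P.βRD m * (P.sumpβ + 1 + P.N₁ M₀ M₁ * P.pS m * P.βSR m)) +
    P.α ^ 2 * P.ρ ^ 2 * γ ^ 2 * M₁ ^ 2 * P.βRD k *
      ((∑ i, P.pS i * P.βSR i ^ 2 * P.βRD i) + P.pS k * P.βSR k ^ 2 * P.βRD k)

end RelayParams

end

/-! Conditionally on the channels, the symbols, the thermal noise and the two quantization noises
form one uncorrelated family (`isCondOrthogonal_all`). Every signal in the system is a linear
combination of this family whose coefficients are polynomials in the channel entries, so each power
or correlation is a sum of expectations of products of coefficients with conditional variances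
(`integral_sum_mul_star_sum`).

The quantization noises have only second moments while the coefficients are unbounded. Square
integrability of their products comes from the conditional variances, which have moments of all
orders (`memLp_mul_of_condExp`).

The coefficients separate: those of the matched filter output depend on `GSR` only, and are then
combined with weights that depend on `GRD` only. Since the two matrices are independent and the
weights are mutually uncorrelated, cross terms vanish and each power becomes a weighted sum of the
powers `matchedPower` (`sum_integral_combination`). This covers the relay power, the received signal
and also the DAC noise, whose variance depends on the channels. Wick's formula for complex Gaussians
gives the weights and `matchedPower`.

The desired signal is the symbol times the mean of its coefficient in `yD`. Hence its correlation
with `yD` equals its own power, the effective noise is uncorrelated with it, and the noise power is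
the total received power minus the desired power. That difference is matched with the terms B to G
plus one by the polynomial identity `received_power_eq`. -/

/-! ### Random variables with moments of all orders -/

/-- A complex random variable that is measurable for `m` and has finite moments of all orders. -/
structure HasMoments {Ω : Type*} (m : MeasurableSpace Ω) [mΩ : MeasurableSpace Ω] (μ : Measure Ω)
    (f : Ω → ℂ) : Prop where
  meas : Measurable[m] f
  memLp : ∀ p : ENNReal, p ≠ ⊤ → MemLp f p μ

namespace HasMoments

variable {Ω : Type*} {m m' : MeasurableSpace Ω} [mΩ : MeasurableSpace Ω] {μ : Measure Ω}
  {f g : Ω → ℂ}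

theorem mono (hf : HasMoments m μ f) (h : m ≤ m') : HasMoments m' μ f :=
  ⟨hf.meas.mono h le_rfl, hf.memLp⟩

theorem integrable (hf : HasMoments m μ f) : Integrable f μ :=
  memLp_one_iff_integrable.1 (hf.memLp 1 (by simp))

theorem const [IsFiniteMeasure μ] (c : ℂ) : HasMoments m μ fun _ => c :=
  ⟨measurable_const, fun _ _ => memLp_const c⟩

theorem add (hf : HasMoments m μ f) (hg : HasMoments m μ g) :
    HasMoments m μ fun ω => f ω + g ω :=
  ⟨hf.meas.add hg.meas, fun p hp => (hf.memLp p hp).add (hg.memLp p hp)⟩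

/-- Hölder's inequality asks for exponent 2p on both factors. Requiring all finite exponents at once
is what makes the class stable under products, hence under polynomials in the channel entries. -/
theorem mul (hf : HasMoments m μ f) (hg : HasMoments m μ g) :
    HasMoments m μ fun ω => f ω * g ω := by
  refine ⟨hf.meas.mul hg.meas, fun p hp => ?_⟩
  have h2 : 2 * p ≠ ⊤ := ENNReal.mul_ne_top (by simp) hp
  have : ENNReal.HolderTriple (2 * p) (2 * p) p := ⟨by
    rw [ENNReal.mul_inv (by simp) (by simp), ← add_mul, ENNReal.inv_two_add_inv_two, one_mul]⟩
  exact (hg.memLp _ h2).mul' (hf.memLp _ h2)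

theorem star (hf : HasMoments m μ f) : HasMoments m μ fun ω => star (f ω) :=
  ⟨continuous_star.measurable.comp hf.meas, fun p hp => (hf.memLp p hp).star⟩

theorem const_mul [IsFiniteMeasure μ] (c : ℂ) (hf : HasMoments m μ f) :
    HasMoments m μ fun ω => c * f ω :=
  (const c).mul hf

theorem sum {ι : Type*} (s : Finset ι) {F : ι → Ω → ℂ}
    (hF : ∀ i, HasMoments m μ (F i)) : HasMoments m μ fun ω => ∑ i ∈ s, F i ω := by
  refine ⟨?_, fun p hp => memLp_finsetSum s fun i _ => (hF i).memLp p hp⟩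
  exact Finset.measurable_fun_sum s fun i _ => (hF i).meas

theorem integral_mul_of_indep (hm : m ≤ mΩ) (hm' : m' ≤ mΩ) (hind : Indep m m' μ)
    (hf : HasMoments m μ f) (hg : HasMoments m' μ g) :
    ∫ ω, f ω * g ω ∂μ = (∫ ω, f ω ∂μ) * ∫ ω, g ω ∂μ := by
  have hi : IndepFun f g μ :=
    indep_of_indep_of_le_left (indep_of_indep_of_le_right hind hg.meas.comap_le) hf.meas.comap_le
  exact hi.integral_fun_mul_eq_mul_integral (hf.meas.mono hm le_rfl).aestronglyMeasurable
    (hg.meas.mono hm' le_rfl).aestronglyMeasurable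

end HasMoments

/-! ### Conditionally orthogonal families -/

theorem mul_star_eq_normSq_cast (z : ℂ) : z * star z = ((‖z‖ ^ 2 : ℝ) : ℂ) := by
  rw [Complex.star_def, Complex.mul_conj, Complex.normSq_eq_norm_sq]

theorem integral_mul_star_eq {Ω : Type*} [MeasurableSpace Ω] (μ : Measure Ω) (f : Ω → ℂ) :
    ∫ ω, f ω * star (f ω) ∂μ = ((∫ ω, ‖f ω‖ ^ 2 ∂μ : ℝ) : ℂ) := by
  rw [← integral_complex_ofReal]
  exact integral_congr_ae (Filter.Eventually.of_forall fun ω => mul_star_eq_normSq_cast _)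

/-- A finite family of square integrable signals that are uncorrelated conditionally on `m`, with
conditional second moments `v`. -/
structure IsCondOrthogonal {Ω ι : Type*} (m : MeasurableSpace Ω) [mΩ : MeasurableSpace Ω]
    (μ : Measure Ω) (e : ι → Ω → ℂ) (v : ι → Ω → ℝ) : Prop where
  memLp : ∀ i, MemLp (e i) 2 μ
  nonneg : ∀ i ω, 0 ≤ v i ω
  hasMoments : ∀ i, HasMoments m μ fun ω => (v i ω : ℂ)
  cross : ∀ i j, i ≠ j → μ[fun ω => e i ω * star (e j ω) | m] =ᵐ[μ] 0
  diag : ∀ i, μ[fun ω => e i ω * star (e i ω) | m] =ᵐ[μ] fun ω => (v i ω : ℂ)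

section

variable {Ω : Type*} {m : MeasurableSpace Ω} [mΩ : MeasurableSpace Ω] {μ : Measure Ω}

theorem integrable_mul_star {e f : Ω → ℂ} (he : MemLp e 2 μ) (hf : MemLp f 2 μ) :
    Integrable (fun ω => e ω * star (f ω)) μ :=
  he.integrable_mul hf.star

/-- A random coefficient that is measurable for `m` multiplies a square integrable signal of
conditional power `v` to a square integrable signal as soon as `|c|² v` is integrable. -/
theorem memLp_mul_of_condExp [IsFiniteMeasure μ] (hm : m ≤ mΩ) {e c : Ω → ℂ} {v : Ω → ℝ}
    (he : MemLp e 2 μ) (hv : ∀ ω, 0 ≤ v ω) (hvm : HasMoments m μ fun ω => (v ω : ℂ))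
    (hev : μ[fun ω => e ω * star (e ω) | m] =ᵐ[μ] fun ω => (v ω : ℂ))
    (hc : HasMoments m μ c) : MemLp (fun ω => c ω * e ω) 2 μ := by
  have hcm : AEStronglyMeasurable c μ := (hc.meas.mono hm le_rfl).aestronglyMeasurable
  have hmeas : AEStronglyMeasurable (fun ω => c ω * e ω) μ := hcm.mul he.1
  rw [memLp_two_iff_integrable_sq_norm hmeas]
  have hvi : Integrable v μ := by simpa using hvm.integrable.re
  have hei : Integrable (fun ω => ‖e ω‖ ^ 2) μ := (memLp_two_iff_integrable_sq_norm he.1).1 he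
  -- Pulling |c|² out of the conditional expectation would presuppose the integrability to be
  -- proved. Instead, the measures with densities |e|² and v agree on `m`, so they integrate the
  -- nonnegative `m`-measurable function |c|² to the same value, finite because c and v have all
  -- moments.
  have key : ∀ s, MeasurableSet[m] s →
      ∫⁻ ω in s, ENNReal.ofReal (‖e ω‖ ^ 2) ∂μ = ∫⁻ ω in s, ENNReal.ofReal (v ω) ∂μ := by
    intro s hs
    rw [← ofReal_integral_eq_lintegral_ofReal hei.integrableOn
        (Filter.Eventually.of_forall fun ω => by positivity),
      ← ofReal_integral_eq_lintegral_ofReal hvi.integrableOn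
        (Filter.Eventually.of_forall hv)]
    congr 1
    have h1 := setIntegral_condExp hm (integrable_mul_star he he) hs
    rw [setIntegral_congr_ae (g := fun ω => (v ω : ℂ)) (hm s hs)
      (hev.mono fun ω h _ => h), integral_mul_star_eq, integral_complex_ofReal] at h1
    exact_mod_cast h1.symm
  have htrim : (μ.withDensity fun ω => ENNReal.ofReal (‖e ω‖ ^ 2)).trim hm =
      (μ.withDensity fun ω => ENNReal.ofReal (v ω)).trim hm := by
    refine @Measure.ext _ m _ _ fun s hs => ?_
    rw [trim_measurableSet_eq hm hs, trim_measurableSet_eq hm hs, withDensity_apply _ (hm s hs),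
      withDensity_apply _ (hm s hs), key s hs]
  have hcE : Measurable[m] fun ω => ENNReal.ofReal (‖c ω‖ ^ 2) :=
    ENNReal.measurable_ofReal.comp ((measurable_norm.comp hc.meas).pow_const 2)
  have hlint : ∫⁻ ω, ENNReal.ofReal (‖e ω‖ ^ 2) * ENNReal.ofReal (‖c ω‖ ^ 2) ∂μ =
      ∫⁻ ω, ENNReal.ofReal (v ω) * ENNReal.ofReal (‖c ω‖ ^ 2) ∂μ := by
    have := congrArg (fun ν => @lintegral Ω m ν fun ω => ENNReal.ofReal (‖c ω‖ ^ 2)) htrim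
    simp only [lintegral_trim hm hcE] at this
    rwa [lintegral_withDensity_eq_lintegral_mul₀ hei.1.aemeasurable.ennreal_ofReal
        (hcE.mono hm le_rfl).aemeasurable,
      lintegral_withDensity_eq_lintegral_mul₀ hvi.1.aemeasurable.ennreal_ofReal
        (hcE.mono hm le_rfl).aemeasurable] at this
  have hcv : Integrable (fun ω => ‖c ω‖ ^ 2 * v ω) μ := by
    have := ((hc.mul hc.star).mul hvm).integrable.re
    refine this.congr (Filter.Eventually.of_forall fun ω => ?_)
    simp only [mul_star_eq_normSq_cast, ← Complex.ofReal_mul]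
    rfl
  refine ⟨hmeas.norm.pow 2, ?_⟩
  rw [hasFiniteIntegral_iff_ofReal (Filter.Eventually.of_forall fun ω => by positivity)]
  have h2 := (hasFiniteIntegral_iff_ofReal
    (Filter.Eventually.of_forall fun ω => by have := hv ω; positivity)).1 hcv.2
  calc _ = ∫⁻ ω, ENNReal.ofReal (‖e ω‖ ^ 2) * ENNReal.ofReal (‖c ω‖ ^ 2) ∂μ := by
        refine lintegral_congr fun ω => ?_
        rw [norm_mul, mul_pow, mul_comm, ENNReal.ofReal_mul (by positivity)]
    _ = ∫⁻ ω, ENNReal.ofReal (‖c ω‖ ^ 2 * v ω) ∂μ := by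
        rw [hlint]
        refine lintegral_congr fun ω => ?_
        rw [mul_comm, ENNReal.ofReal_mul (by positivity)]
    _ < ⊤ := h2

/-- The coefficient `c * star d` is measurable for `m` and comes out of the conditional expectation.
Square integrability of the two weighted signals supplies the integrability this needs. -/
theorem condExp_mul_star_mul [IsFiniteMeasure μ] {e f c d : Ω → ℂ}
    (he : MemLp e 2 μ) (hf : MemLp f 2 μ) (hce : MemLp (fun ω => c ω * e ω) 2 μ)
    (hdf : MemLp (fun ω => d ω * f ω) 2 μ) (hc : Measurable[m] c) (hd : Measurable[m] d) :
    μ[fun ω => (c ω * e ω) * star (d ω * f ω) | m] =ᵐ[μ]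
      fun ω => c ω * star (d ω) * (μ[fun ω => e ω * star (f ω) | m]) ω := by
  have hcd : Measurable[m] fun ω => c ω * star (d ω) :=
    hc.mul (continuous_star.measurable.comp hd)
  have heq : (fun ω => (c ω * e ω) * star (d ω * f ω)) =
      fun ω => (ContinuousLinearMap.mul ℝ ℂ) (c ω * star (d ω)) (e ω * star (f ω)) := by
    funext ω
    simp only [ContinuousLinearMap.mul_apply', star_mul']
    ring
  have := condExp_bilin_of_stronglyMeasurable_left (ContinuousLinearMap.mul ℝ ℂ)
    hcd.stronglyMeasurable (heq ▸ integrable_mul_star hce hdf) (integrable_mul_star he hf)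
  rw [heq]
  exact this

end

namespace IsCondOrthogonal

variable {Ω ι : Type*} {m : MeasurableSpace Ω} [mΩ : MeasurableSpace Ω] {μ : Measure Ω}
  [IsFiniteMeasure μ] {e : ι → Ω → ℂ} {v : ι → Ω → ℝ} {c d : ι → Ω → ℂ}

theorem memLp_mul (h : IsCondOrthogonal m μ e v) (hm : m ≤ mΩ) (i : ι) {c : Ω → ℂ}
    (hc : HasMoments m μ c) : MemLp (fun ω => c ω * e i ω) 2 μ :=
  memLp_mul_of_condExp hm (h.memLp i) (h.nonneg i) (h.hasMoments i) (h.diag i) hc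

/-- A bank of converters whose input has conditional power `r` adds its quantization noise to a
conditionally orthogonal family. -/
theorem sumElim_noise {n κ : Type*} {ρ : ℝ} (hρ : 0 ≤ ρ) (hρ' : ρ ≤ 1)
    {input noise : Ω → n → ℂ} {others : Ω → κ → ℂ} {r : n → Ω → ℝ}
    (h : IsCondOrthogonal m μ e v)
    (hq : IsQuantizationNoise m μ ρ input noise others) (σ : ι → κ)
    (hσ : ∀ i ω, others ω (σ i) = e i ω)
    (hr : ∀ a ω, 0 ≤ r a ω) (hrm : ∀ a, HasMoments m μ fun ω => (r a ω : ℂ))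
    (hir : ∀ a, μ[fun ω => input ω a * star (input ω a) | m] =ᵐ[μ] fun ω => (r a ω : ℂ)) :
    IsCondOrthogonal m μ (Sum.elim e fun a ω => noise ω a)
      (Sum.elim v fun a ω => (1 - ρ) * ρ * r a ω) where
  memLp := by
    rintro (i | a)
    exacts [h.memLp i, hq.memLp a]
  nonneg := by
    rintro (i | a) ω
    · exact h.nonneg i ω
    · have h1 : 0 ≤ 1 - ρ := by linarith
      have h2 := hr a ω
      simp only [Sum.elim_inr]
      positivity
  hasMoments := by
    rintro (i | a)
    · exact h.hasMoments i
    · simpa using (hrm a).const_mul ((1 - ρ) * ρ : ℂ)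
  cross := by
    have hu : ∀ a i, μ[fun ω => noise ω a * star (e i ω) | m] =ᵐ[μ] 0 := fun a i => by
      simpa only [hσ] using hq.uncorrelated a (σ i)
    rintro (i | a) (j | b) hij
    · exact h.cross i j fun h => hij (by rw [h])
    -- The model gives only the order noise times conjugate signal; the other order follows since
    -- conjugation commutes with conditional expectation.
    · have hs := (Complex.conjCLE : ℂ →L[ℝ] ℂ).comp_condExp_comm (m := m)
        (integrable_mul_star (hq.memLp b) (h.memLp i))
      have heq : ((Complex.conjCLE : ℂ →L[ℝ] ℂ) ∘ fun ω => noise ω b * star (e i ω)) =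
          fun ω => e i ω * star (noise ω b) := by
        funext ω
        simp [mul_comm]
      rw [heq] at hs
      simp only [Sum.elim_inl, Sum.elim_inr]
      filter_upwards [hs, hu b i] with ω h1 h2
      rw [← h1, Function.comp_apply, h2]
      simp
    · exact hu a j
    · exact hq.cov_offdiag a b fun h => hij (by rw [h])
  diag := by
    rintro (i | a)
    · exact h.diag i
    · simp only [Sum.elim_inr]
      filter_upwards [hq.cov_diag a, hir a] with ω h1 h2
      rw [h1, h2]
      push_cast
      rfl

variable [Fintype ι]

theorem memLp_sum (h : IsCondOrthogonal m μ e v) (hm : m ≤ mΩ)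
    (hc : ∀ i, HasMoments m μ (c i)) : MemLp (fun ω => ∑ i, c i ω * e i ω) 2 μ :=
  memLp_finsetSum _ fun i _ => h.memLp_mul hm i (hc i)

/-- Conditional Pythagoras: the product expands into a double sum, the coefficients come out, and
only the diagonal survives. -/
theorem condExp_sum_mul_star_sum (h : IsCondOrthogonal m μ e v) (hm : m ≤ mΩ)
    (hc : ∀ i, HasMoments m μ (c i)) (hd : ∀ i, HasMoments m μ (d i)) :
    μ[fun ω => (∑ i, c i ω * e i ω) * star (∑ i, d i ω * e i ω) | m] =ᵐ[μ]
      fun ω => ∑ i, c i ω * star (d i ω) * v i ω := by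
  classical
  have heq : (fun ω => (∑ i, c i ω * e i ω) * star (∑ i, d i ω * e i ω)) =
      ∑ i, ∑ j, fun ω => (c i ω * e i ω) * star (d j ω * e j ω) := by
    funext ω
    simp only [star_sum, Finset.sum_mul_sum, Finset.sum_apply]
  have hint : ∀ i j, Integrable (fun ω => (c i ω * e i ω) * star (d j ω * e j ω)) μ := fun i j =>
    integrable_mul_star (h.memLp_mul hm i (hc i)) (h.memLp_mul hm j (hd j))
  have hterm : ∀ i j, μ[fun ω => (c i ω * e i ω) * star (d j ω * e j ω) | m] =ᵐ[μ]
      fun ω => if i = j then c i ω * star (d i ω) * v i ω else 0 := by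
    intro i j
    refine (condExp_mul_star_mul (h.memLp i) (h.memLp j) (h.memLp_mul hm i (hc i))
      (h.memLp_mul hm j (hd j)) (hc i).meas (hd j).meas).trans ?_
    by_cases hij : i = j
    · subst hij
      filter_upwards [h.diag i] with ω hω
      rw [hω, if_pos rfl]
    · filter_upwards [h.cross i j hij] with ω hω
      rw [hω, if_neg hij, Pi.zero_apply, mul_zero]
  rw [heq]
  refine (condExp_finsetSum (fun i _ => integrable_finsetSum' _ fun j _ => hint i j) m).trans ?_
  have h1 : ∀ i, μ[∑ j, fun ω => (c i ω * e i ω) * star (d j ω * e j ω) | m] =ᵐ[μ]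
      fun ω => c i ω * star (d i ω) * v i ω := by
    intro i
    refine (condExp_finsetSum (fun j _ => hint i j) m).trans ?_
    filter_upwards [ae_all_iff.2 (hterm i)] with ω hω
    rw [Finset.sum_apply, Finset.sum_congr rfl fun j _ => hω j, Finset.sum_ite_eq,
      if_pos (Finset.mem_univ _)]
  filter_upwards [ae_all_iff.2 h1] with ω hω
  rw [Finset.sum_apply, Finset.sum_congr rfl fun j _ => hω j]

theorem integral_sum_mul_star_sum (h : IsCondOrthogonal m μ e v) (hm : m ≤ mΩ)
    (hc : ∀ i, HasMoments m μ (c i)) (hd : ∀ i, HasMoments m μ (d i)) :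
    ∫ ω, (∑ i, c i ω * e i ω) * star (∑ i, d i ω * e i ω) ∂μ =
      ∑ i, ∫ ω, c i ω * star (d i ω) * v i ω ∂μ := by
  rw [← integral_condExp hm, integral_congr_ae (h.condExp_sum_mul_star_sum hm hc hd),
    integral_finsetSum]
  exact fun i _ => (((hc i).mul (hd i).star).mul (h.hasMoments i)).integrable

end IsCondOrthogonal

/-! ### Moments of real and complex Gaussian laws -/

theorem integral_pow_four_gaussianReal (v : NNReal) :
    ∫ x, x ^ 4 ∂(gaussianReal 0 v) = 3 * (v : ℝ) ^ 2 := by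
  have h : mgf (fun x => x) (gaussianReal 0 v) = fun t => Real.exp (v * t ^ 2 / 2) := by
    rw [mgf_fun_id_gaussianReal]
    simp
  have h0 : ∫ x, x ^ 4 ∂(gaussianReal 0 v) =
      iteratedDeriv 4 (mgf (fun x => x) (gaussianReal 0 v)) 0 := by
    rw [iteratedDeriv_mgf_zero] <;> simp
  -- Differentiating p(t) exp(v t²/2) replaces the polynomial p by p' + v t p. Four steps from p =
  -- 1, evaluated at 0, leave 3v².
  have step (p p' : ℝ → ℝ) (hp : ∀ t, HasDerivAt p (p' t) t) :
      deriv (fun t => p t * Real.exp (v * t ^ 2 / 2)) =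
        fun t => (p' t + p t * (v * t)) * Real.exp (v * t ^ 2 / 2) := by
    funext t
    have h1 : HasDerivAt (fun t : ℝ => (v : ℝ) * t ^ 2 / 2) (v * t) t := by
      refine (((hasDerivAt_pow 2 t).const_mul (v : ℝ)).div_const 2).congr_deriv ?_
      push_cast
      ring
    have h2 : HasDerivAt (fun t => p t * Real.exp (v * t ^ 2 / 2)) _ t := (hp t).mul h1.exp
    rw [h2.deriv]
    ring
  have e0 : (fun t : ℝ => Real.exp (v * t ^ 2 / 2)) =
      fun t => (fun _ => (1 : ℝ)) t * Real.exp (v * t ^ 2 / 2) := by simp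
  have e1 := step (fun _ => 1) (fun _ => 0) fun t => hasDerivAt_const t 1
  have e2 := step (fun t => 0 + 1 * (v * t)) (fun _ => v) fun t => by
    simpa using (hasDerivAt_id t).const_mul (v : ℝ)
  have e3 := step (fun t => v + (0 + 1 * (v * t)) * (v * t)) (fun t => 2 * v ^ 2 * t) fun t => by
    have h1 : HasDerivAt (fun t : ℝ => v + (v : ℝ) ^ 2 * t ^ 2) (2 * v ^ 2 * t) t := by
      refine (((hasDerivAt_pow 2 t).const_mul ((v : ℝ) ^ 2)).const_add (v : ℝ)).congr_deriv ?_
      push_cast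
      ring
    refine h1.congr_of_eventuallyEq (Filter.Eventually.of_forall fun t => ?_)
    ring
  have e4 := step (fun t => 2 * v ^ 2 * t + (v + (0 + 1 * (v * t)) * (v * t)) * (v * t))
    (fun t => 3 * v ^ 2 + 3 * v ^ 3 * t ^ 2) fun t => by
      have h1 : HasDerivAt (fun t : ℝ => 3 * (v : ℝ) ^ 2 * t + (v : ℝ) ^ 3 * t ^ 3)
          (3 * v ^ 2 + 3 * v ^ 3 * t ^ 2) t := by
        refine (((hasDerivAt_id' t).const_mul (3 * (v : ℝ) ^ 2)).add
          ((hasDerivAt_pow 3 t).const_mul ((v : ℝ) ^ 3))).congr_deriv ?_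
        push_cast
        ring
      refine h1.congr_of_eventuallyEq (Filter.Eventually.of_forall fun t => ?_)
      ring
  rw [h0, h, iteratedDeriv_succ, iteratedDeriv_succ, iteratedDeriv_succ, iteratedDeriv_one, e0, e1,
    e2, e3, e4]
  simp

section ComplexGaussian

variable {v : ℝ}

theorem measurable_complex_mk : Measurable fun z : ℝ × ℝ => (⟨z.1, z.2⟩ : ℂ) :=
  Complex.measurableEquivRealProd.symm.measurable

theorem integral_complexGaussian (f : ℂ → ℂ) (hf : Continuous f) :
    ∫ z, f z ∂(complexGaussian v) =
      ∫ z : ℝ × ℝ, f ⟨z.1, z.2⟩ ∂((gaussianReal 0 (v / 2).toNNReal).prod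
        (gaussianReal 0 (v / 2).toNNReal)) :=
  integral_map measurable_complex_mk.aemeasurable hf.aestronglyMeasurable

theorem integrable_pow_gaussianReal (v : NNReal) (n : ℕ) :
    Integrable (fun x : ℝ => ((x : ℂ)) ^ n) (gaussianReal 0 v) := by
  have h : MemLp (fun x : ℝ => (x : ℂ)) n (gaussianReal 0 v) :=
    (memLp_id_gaussianReal' n (by simp)).ofReal
  refine (integrable_norm_iff ?_).1 ?_
  · fun_prop
  · simpa only [norm_pow] using h.integrable_norm_pow'

theorem integrable_monomial_gaussianReal (v : NNReal) (c : ℂ) (i j : ℕ) :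
    Integrable (fun z : ℝ × ℝ => c * ((z.1 : ℂ) ^ i * (z.2 : ℂ) ^ j))
      ((gaussianReal 0 v).prod (gaussianReal 0 v)) :=
  ((integrable_pow_gaussianReal v i).mul_prod (integrable_pow_gaussianReal v j)).const_mul c

theorem integral_monomial_gaussianReal (v : NNReal) (c : ℂ) (i j : ℕ) :
    ∫ z : ℝ × ℝ, c * ((z.1 : ℂ) ^ i * (z.2 : ℂ) ^ j)
        ∂((gaussianReal 0 v).prod (gaussianReal 0 v)) =
      c * (((∫ x, x ^ i ∂(gaussianReal 0 v) : ℝ) : ℂ) *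
        ((∫ x, x ^ j ∂(gaussianReal 0 v) : ℝ) : ℂ)) := by
  rw [integral_const_mul, integral_prod_mul (fun x : ℝ => (x : ℂ) ^ i) fun x : ℝ => (x : ℂ) ^ j]
  simp only [← Complex.ofReal_pow, integral_complex_ofReal]

theorem integral_three_monomials_gaussianReal (v : NNReal) (c c' c'' : ℂ) (i j i' j' i'' j'' : ℕ) :
    ∫ z : ℝ × ℝ, c * ((z.1 : ℂ) ^ i * (z.2 : ℂ) ^ j) + c' * ((z.1 : ℂ) ^ i' * (z.2 : ℂ) ^ j') +
        c'' * ((z.1 : ℂ) ^ i'' * (z.2 : ℂ) ^ j'') ∂((gaussianReal 0 v).prod (gaussianReal 0 v)) =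
      c * (((∫ x, x ^ i ∂(gaussianReal 0 v) : ℝ) : ℂ) *
        ((∫ x, x ^ j ∂(gaussianReal 0 v) : ℝ) : ℂ)) +
      c' * (((∫ x, x ^ i' ∂(gaussianReal 0 v) : ℝ) : ℂ) *
        ((∫ x, x ^ j' ∂(gaussianReal 0 v) : ℝ) : ℂ)) +
      c'' * (((∫ x, x ^ i'' ∂(gaussianReal 0 v) : ℝ) : ℂ) *
        ((∫ x, x ^ j'' ∂(gaussianReal 0 v) : ℝ) : ℂ)) := by
  have h1 := integrable_monomial_gaussianReal v c i j
  have h2 := integrable_monomial_gaussianReal v c' i' j'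
  rw [integral_add (h1.add h2 : Integrable (fun z : ℝ × ℝ => _ + _) _)
    (integrable_monomial_gaussianReal _ _ _ _), integral_add h1 h2,
    integral_monomial_gaussianReal, integral_monomial_gaussianReal, integral_monomial_gaussianReal]

theorem integral_pow_one_gaussianReal (v : NNReal) : ∫ x, x ^ 1 ∂(gaussianReal 0 v) = 0 := by
  simp

theorem integral_pow_two_gaussianReal (v : NNReal) : ∫ x, x ^ 2 ∂(gaussianReal 0 v) = v := by
  rw [← variance_fun_id_gaussianReal (μ := 0) (v := v), variance_of_integral_eq_zero]
  · fun_prop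
  · simp

theorem integral_id_complexGaussian : ∫ z, z ∂(complexGaussian v) = 0 := by
  rw [integral_complexGaussian _ continuous_id']
  have : (fun z : ℝ × ℝ => (⟨z.1, z.2⟩ : ℂ)) = fun z =>
      1 * ((z.1 : ℂ) ^ 1 * (z.2 : ℂ) ^ 0) + Complex.I * ((z.1 : ℂ) ^ 0 * (z.2 : ℂ) ^ 1) := by
    funext z
    rw [Complex.mk_eq_add_mul_I]
    ring
  rw [this, integral_add (integrable_monomial_gaussianReal _ _ _ _)
    (integrable_monomial_gaussianReal _ _ _ _), integral_monomial_gaussianReal,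
    integral_monomial_gaussianReal, integral_pow_one_gaussianReal]
  simp

theorem integral_star_complexGaussian : ∫ z, star z ∂(complexGaussian v) = 0 := by
  have := integral_conj (𝕜 := ℂ) (μ := complexGaussian v) (f := fun z => z)
  rw [integral_id_complexGaussian, map_zero] at this
  exact this

/-- Circular symmetry: the real and imaginary parts are uncorrelated with equal variances, so the
second moments cancel. -/
theorem integral_mul_self_complexGaussian : ∫ z, z * z ∂(complexGaussian v) = 0 := by
  rw [integral_complexGaussian _ (by fun_prop)]
  have : (fun z : ℝ × ℝ => (⟨z.1, z.2⟩ : ℂ) * ⟨z.1, z.2⟩) = fun z =>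
      1 * ((z.1 : ℂ) ^ 2 * (z.2 : ℂ) ^ 0) + (-1) * ((z.1 : ℂ) ^ 0 * (z.2 : ℂ) ^ 2) +
        2 * Complex.I * ((z.1 : ℂ) ^ 1 * (z.2 : ℂ) ^ 1) := by
    funext z
    rw [Complex.mk_eq_add_mul_I]
    ring_nf
    rw [Complex.I_sq]
    ring
  rw [this, integral_three_monomials_gaussianReal, integral_pow_one_gaussianReal,
    integral_pow_two_gaussianReal]
  simp

theorem integral_mul_star_complexGaussian (hv : 0 ≤ v) :
    ∫ z, z * star z ∂(complexGaussian v) = v := by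
  rw [integral_complexGaussian _ (by fun_prop)]
  have : (fun z : ℝ × ℝ => (⟨z.1, z.2⟩ : ℂ) * star ⟨z.1, z.2⟩) = fun z =>
      1 * ((z.1 : ℂ) ^ 2 * (z.2 : ℂ) ^ 0) + 1 * ((z.1 : ℂ) ^ 0 * (z.2 : ℂ) ^ 2) := by
    funext z
    rw [Complex.star_def, Complex.mul_conj, Complex.normSq_mk]
    push_cast
    ring
  rw [this, integral_add (integrable_monomial_gaussianReal _ _ _ _)
    (integrable_monomial_gaussianReal _ _ _ _), integral_monomial_gaussianReal,
    integral_monomial_gaussianReal, integral_pow_two_gaussianReal,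
    Real.coe_toNNReal _ (by positivity)]
  simp

/-- With z = x + iy, |z|⁴ = x⁴ + y⁴ + 2x²y², whose mean is (3 + 3 + 2)(v/2)². -/
theorem integral_mul_star_sq_complexGaussian (hv : 0 ≤ v) :
    ∫ z, z * star z * z * star z ∂(complexGaussian v) = 2 * v ^ 2 := by
  rw [integral_complexGaussian _ (by fun_prop)]
  have : (fun z : ℝ × ℝ => (⟨z.1, z.2⟩ : ℂ) * star ⟨z.1, z.2⟩ * ⟨z.1, z.2⟩ * star ⟨z.1, z.2⟩) =
      fun z => 1 * ((z.1 : ℂ) ^ 4 * (z.2 : ℂ) ^ 0) + 1 * ((z.1 : ℂ) ^ 0 * (z.2 : ℂ) ^ 4) +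
        2 * ((z.1 : ℂ) ^ 2 * (z.2 : ℂ) ^ 2) := by
    funext z
    rw [mul_assoc _ (⟨z.1, z.2⟩ : ℂ), Complex.star_def, Complex.mul_conj, Complex.normSq_mk]
    push_cast
    ring
  rw [this, integral_three_monomials_gaussianReal, integral_pow_four_gaussianReal,
    integral_pow_two_gaussianReal, Real.coe_toNNReal _ (by positivity)]
  simp
  ring

theorem memLp_id_complexGaussian (p : ENNReal) (hp : p ≠ ⊤) :
    MemLp (fun z : ℂ => z) p (complexGaussian v) := by
  rw [complexGaussian, memLp_map_measure_iff (by fun_prop) measurable_complex_mk.aemeasurable,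
    ← memLp_re_im_iff]
  exact ⟨(memLp_id_gaussianReal' p hp).comp_fst _, (memLp_id_gaussianReal' p hp).comp_snd _⟩

end ComplexGaussian

/-! ### Independent families of complex Gaussian variables -/

/-- An independent family of complex Gaussian variables of variances `v`. -/
structure IsGaussianFamily {Ω ι : Type*} [MeasurableSpace Ω] (μ : Measure Ω) (z : ι → Ω → ℂ)
    (v : ι → ℝ) : Prop where
  measurable : ∀ i, Measurable (z i)
  map_eq : ∀ i, μ.map (z i) = complexGaussian (v i)
  indep : iIndepFun z μ
  nonneg : ∀ i, 0 ≤ v i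

namespace IsGaussianFamily

theorem hasMoments {Ω ι : Type*} (m : MeasurableSpace Ω) [mΩ : MeasurableSpace Ω] {μ : Measure Ω}
    {z : ι → Ω → ℂ} {v : ι → ℝ} (h : IsGaussianFamily μ z v) (i : ι) (hi : Measurable[m] (z i)) :
    HasMoments m μ (z i) := by
  refine ⟨hi, fun p hp => ?_⟩
  have := memLp_id_complexGaussian (v := v i) p hp
  rw [← h.map_eq i, memLp_map_measure_iff (by fun_prop) (h.measurable i).aemeasurable] at this
  exact this

variable {Ω ι : Type*} [mΩ : MeasurableSpace Ω] {μ : Measure Ω} {z : ι → Ω → ℂ} {v : ι → ℝ}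

theorem integral_comp (h : IsGaussianFamily μ z v) (i : ι) {f : ℂ → ℂ} (hf : Continuous f) :
    ∫ ω, f (z i ω) ∂μ = ∫ w, f w ∂(complexGaussian (v i)) := by
  rw [← h.map_eq i, integral_map (h.measurable i).aemeasurable hf.aestronglyMeasurable]

theorem integral_eq_zero (h : IsGaussianFamily μ z v) (i : ι) : ∫ ω, z i ω ∂μ = 0 :=
  (h.integral_comp i continuous_id').trans integral_id_complexGaussian

theorem integral_mul_comp (h : IsGaussianFamily μ z v) {i j : ι} (hij : i ≠ j) {f g : ℂ → ℂ}
    (hf : Continuous f) (hg : Continuous g) :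
    ∫ ω, f (z i ω) * g (z j ω) ∂μ = (∫ ω, f (z i ω) ∂μ) * ∫ ω, g (z j ω) ∂μ :=
  (h.indep.indepFun hij).integral_fun_comp_mul_comp (h.measurable i).aemeasurable
    (h.measurable j).aemeasurable hf.aestronglyMeasurable hg.aestronglyMeasurable

variable [DecidableEq ι]

theorem integral_mul_star (h : IsGaussianFamily μ z v) (i j : ι) :
    ∫ ω, z i ω * star (z j ω) ∂μ = if i = j then (v i : ℂ) else 0 := by
  split_ifs with hij
  · subst hij
    rw [h.integral_comp i (f := fun w => w * star w) (by fun_prop),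
      integral_mul_star_complexGaussian (h.nonneg i)]
  · rw [h.integral_mul_comp hij (f := fun w => w) (g := fun w => star w) (by fun_prop)
      (by fun_prop), h.integral_eq_zero, zero_mul]

/-- The fourth order moments that are not balanced vanish. -/
theorem integral_mul_four_eq_zero [Fintype ι] (h : IsGaussianFamily μ z v) (i j k l s : ι)
    (hs : ((s = i ∨ s = k) ∧ s ≠ j ∧ s ≠ l) ∨ (s = l ∧ s ≠ i ∧ s ≠ j ∧ s ≠ k)) :
    ∫ ω, z i ω * star (z j ω) * z k ω * star (z l ω) ∂μ = 0 := by
  -- Collects the factors that involve the same variable, so that independence gives one expectation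
  -- per index. The one at `s` is a mean of z, z² or its conjugate, hence zero.
  let F : ι → ℂ → ℂ := fun s w => (if s = i then w else 1) * (if s = j then star w else 1) *
    (if s = k then w else 1) * (if s = l then star w else 1)
  have hF : ∀ s, Continuous (F s) := fun s => by
    simp only [F]
    split_ifs <;> fun_prop
  have hprod : (fun ω => z i ω * star (z j ω) * z k ω * star (z l ω)) =
      fun ω => ∏ s, F s (z s ω) := by
    funext ω
    simp only [F, Finset.prod_mul_distrib, Finset.prod_ite_eq', Finset.mem_univ, if_true]
  rw [hprod, h.indep.integral_fun_prod_comp (fun s => (h.measurable s).aemeasurable)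
    fun s => (hF s).aestronglyMeasurable]
  refine Finset.prod_eq_zero (Finset.mem_univ s) ?_
  rw [h.integral_comp s (hF s)]
  rcases hs with ⟨hs, hj, hl⟩ | ⟨hl, hi, hj, hk⟩
  · by_cases hi : s = i <;> by_cases hk : s = k
    · simp only [F, if_pos hi, if_pos hk, if_neg hj, if_neg hl, mul_one]
      exact integral_mul_self_complexGaussian
    · simp only [F, if_pos hi, if_neg hk, if_neg hj, if_neg hl, mul_one]
      exact integral_id_complexGaussian
    · simp only [F, if_neg hi, if_pos hk, if_neg hj, if_neg hl, mul_one, one_mul]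
      exact integral_id_complexGaussian
    · exact absurd hs (by tauto)
  · simp only [F, if_neg hi, if_neg hk, if_neg hj, if_pos hl, one_mul]
    exact integral_star_complexGaussian

/-- Wick's formula for two factors and two conjugate factors. -/
theorem integral_mul_star_mul_mul_star [Fintype ι] (h : IsGaussianFamily μ z v) (i j k l : ι) :
    ∫ ω, z i ω * star (z j ω) * z k ω * star (z l ω) ∂μ =
      v i * v k * ((if i = j ∧ k = l then 1 else 0) + if i = l ∧ k = j then 1 else 0) := by
  -- The case i = j suffices: if i = l, the two conjugate factors can be exchanged; if i is neither
  -- j nor l, it occurs unconjugated only and the moment vanishes.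
  have main : ∀ k l, ∫ ω, z i ω * star (z i ω) * z k ω * star (z l ω) ∂μ =
      v i * v k * ((if k = l then 1 else 0) + if i = l ∧ k = i then 1 else 0) := by
    intro k l
    by_cases hkl : k = l
    · subst hkl
      by_cases hik : i = k
      · subst hik
        rw [h.integral_comp i (f := fun w => w * star w * w * star w) (by fun_prop),
          integral_mul_star_sq_complexGaussian (h.nonneg i)]
        simp only [and_self, if_true]
        ring
      · simp only [mul_assoc (_ * _) (z k _)]
        rw [h.integral_mul_comp hik (f := fun w => w * star w) (g := fun w => w * star w)
          (by fun_prop) (by fun_prop), h.integral_mul_star, h.integral_mul_star]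
        simp [hik]
    · by_cases hil : i = l
      · subst hil
        rw [h.integral_mul_four_eq_zero i i k i k (by tauto)]
        simp [hkl]
      · rw [h.integral_mul_four_eq_zero i i k l l (by
          right; exact ⟨rfl, Ne.symm hil, Ne.symm hil, Ne.symm hkl⟩)]
        simp [hkl, hil]
  by_cases hij : i = j
  · subst hij
    rw [main k l]
    simp
  · by_cases hil : i = l
    · subst hil
      have hcomm : ∀ ω, z i ω * star (z j ω) * z k ω * star (z i ω) =
        z i ω * star (z i ω) * z k ω * star (z j ω) := fun ω => by ring
      simp only [hcomm]
      rw [main k j]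
      simp [hij]
    · rw [h.integral_mul_four_eq_zero i j k l i (by tauto)]
      simp [hij, hil]

end IsGaussianFamily

/-! ### Weighted Gram matrices of Gaussian matrices -/

/-- If `U` and `V` are independent and the entries of `U` are uncorrelated, then the cross terms of
the second moment of `∑ᵢ Uᵢ Vᵢ` vanish. -/
theorem integral_sum_mul_of_indep {Ω κ : Type*} [Fintype κ] [DecidableEq κ]
    {m m' : MeasurableSpace Ω} [mΩ : MeasurableSpace Ω] {μ : Measure Ω} [IsFiniteMeasure μ]
    (hm : m ≤ mΩ) (hm' : m' ≤ mΩ) (hind : Indep m m' μ) {U V : κ → Ω → ℂ} {r : Ω → ℂ} {a : κ → ℂ}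
    (hU : ∀ i, HasMoments m μ (U i)) (hV : ∀ i, HasMoments m' μ (V i)) (hr : HasMoments m' μ r)
    (ha : ∀ i j, ∫ ω, U i ω * star (U j ω) ∂μ = if i = j then a i else 0) :
    ∫ ω, (∑ i, U i ω * V i ω) * star (∑ i, U i ω * V i ω) * r ω ∂μ =
      ∑ i, a i * ∫ ω, V i ω * star (V i ω) * r ω ∂μ := by
  have heq : ∀ ω, (∑ i, U i ω * V i ω) * star (∑ i, U i ω * V i ω) * r ω =
      ∑ i, ∑ j, (U i ω * star (U j ω)) * (V i ω * star (V j ω) * r ω) := by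
    intro ω
    rw [star_sum, Finset.sum_mul_sum, Finset.sum_mul]
    refine Finset.sum_congr rfl fun i _ => ?_
    rw [Finset.sum_mul]
    refine Finset.sum_congr rfl fun j _ => ?_
    rw [star_mul']
    ring
  have hint : ∀ i j, Integrable
      (fun ω => (U i ω * star (U j ω)) * (V i ω * star (V j ω) * r ω)) μ := fun i j =>
    ((((hU i).mul (hU j).star).mono hm).mul
      ((((hV i).mul (hV j).star).mul hr).mono hm')).integrable
  simp only [heq]
  rw [integral_finsetSum _ fun i _ => integrable_finsetSum _ fun j _ => hint i j]
  refine Finset.sum_congr rfl fun i _ => ?_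
  rw [integral_finsetSum _ fun j _ => hint i j]
  have hij : ∀ j, ∫ ω, (U i ω * star (U j ω)) * (V i ω * star (V j ω) * r ω) ∂μ =
      if i = j then a i * ∫ ω, V i ω * star (V i ω) * r ω ∂μ else 0 := by
    intro j
    rw [((hU i).mul (hU j).star).integral_mul_of_indep hm hm' hind
      (((hV i).mul (hV j).star).mul hr), ha]
    split_ifs with h
    · rw [h]
    · rw [zero_mul]
  simp only [hij, Finset.sum_ite_eq, Finset.mem_univ, if_true]

/-- The entries of the transpose of `Zᴴ diag(w) Z`. -/
def weightedGram {Ω A κ : Type*} [Fintype A] (w : A → ℝ) (Z : Ω → Matrix A κ ℂ) (k l : κ) (ω : Ω) :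
    ℂ :=
  ∑ a, (w a : ℂ) * (Z ω a k * star (Z ω a l))

/-- A random matrix with independent complex Gaussian entries of variance `β k` in column `k`. -/
abbrev IsGaussianMatrix {Ω A κ : Type*} [MeasurableSpace Ω] (μ : Measure Ω)
    (Z : Ω → Matrix A κ ℂ) (β : κ → ℝ) : Prop :=
  IsGaussianFamily μ (fun (q : A × κ) ω => Z ω q.1 q.2) fun q => β q.2

theorem hasMoments_weightedGram {Ω A κ : Type*} [Fintype A] {m : MeasurableSpace Ω}
    [mΩ : MeasurableSpace Ω] {μ : Measure Ω} [IsFiniteMeasure μ] {Z : Ω → Matrix A κ ℂ}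
    (hZ : ∀ a k, HasMoments m μ fun ω => Z ω a k) (w : A → ℝ) (k l : κ) :
    HasMoments m μ (weightedGram w Z k l) :=
  HasMoments.sum _ fun a => ((hZ a k).mul (hZ a l).star).const_mul _

namespace IsGaussianMatrix

variable {Ω A κ : Type*} [mΩ : MeasurableSpace Ω] {μ : Measure Ω} {Z : Ω → Matrix A κ ℂ}
  {β : κ → ℝ}

theorem hasMoments_entry (h : IsGaussianMatrix μ Z β) (a : A) (k : κ) :
    HasMoments mΩ μ fun ω => Z ω a k :=
  IsGaussianFamily.hasMoments mΩ h (a, k) (h.measurable (a, k))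

variable [DecidableEq A] [DecidableEq κ]

theorem integral_entry_mul_star (h : IsGaussianMatrix μ Z β) (a b : A) (k l : κ) :
    ∫ ω, Z ω a k * star (Z ω b l) ∂μ = if a = b ∧ k = l then (β k : ℂ) else 0 := by
  have := h.integral_mul_star (a, k) (b, l)
  simpa only [Prod.mk.injEq] using this

variable [Fintype A]

theorem integral_four_entries [Fintype κ] (h : IsGaussianMatrix μ Z β) (a b c d : A) (k l m n : κ) :
    ∫ ω, Z ω a k * star (Z ω b l) * Z ω c m * star (Z ω d n) ∂μ =
      β k * β m * ((if (a = b ∧ k = l) ∧ (c = d ∧ m = n) then 1 else 0) +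
        if (a = d ∧ k = n) ∧ (c = b ∧ m = l) then 1 else 0) := by
  have := h.integral_mul_star_mul_mul_star (a, k) (b, l) (c, m) (d, n)
  simpa only [Prod.mk.injEq] using this

theorem integral_weightedGram [IsFiniteMeasure μ] (h : IsGaussianMatrix μ Z β) (w : A → ℝ)
    (k l : κ) :
    ∫ ω, weightedGram w Z k l ω ∂μ = if k = l then (((∑ a, w a) * β k : ℝ) : ℂ) else 0 := by
  unfold weightedGram
  rw [integral_finsetSum]
  · simp only [integral_const_mul, h.integral_entry_mul_star, true_and]
    split_ifs
    · push_cast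
      rw [Finset.sum_mul]
    · simp
  · exact fun a _ => (((h.hasMoments_entry a k).mul (h.hasMoments_entry a l).star).const_mul
      _).integrable

/-- Wick's formula leaves two pairings. Pairing across the two Gram entries forces equal antennas
and yields the sum of w²; pairing inside each entry forces k = m = n and yields the square of the
sum of w. Neither occurs for m ≠ n, so the entries of a Gram row are uncorrelated. -/
theorem integral_weightedGram_mul_star [Fintype κ] [IsFiniteMeasure μ] (h : IsGaussianMatrix μ Z β)
    (w : A → ℝ) (k m n : κ) :
    ∫ ω, weightedGram w Z k m ω * star (weightedGram w Z k n ω) ∂μ =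
      if m = n then (((∑ a, w a ^ 2) * β k * β m +
        if k = m then (∑ a, w a) ^ 2 * β k ^ 2 else 0 : ℝ) : ℂ) else 0 := by
  have heq : ∀ ω, weightedGram w Z k m ω * star (weightedGram w Z k n ω) =
      ∑ a, ∑ b, ((w a : ℂ) * w b) * (Z ω a k * star (Z ω a m) * Z ω b n * star (Z ω b k)) := by
    intro ω
    simp only [weightedGram, star_sum, Finset.sum_mul_sum]
    refine Finset.sum_congr rfl fun a _ => Finset.sum_congr rfl fun b _ => ?_
    simp only [star_mul', Complex.star_def, Complex.conj_ofReal, RingHomCompTriple.comp_apply,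
      RingHom.id_apply]
    ring
  have hZ := h.hasMoments_entry
  have hint : ∀ a b, Integrable (fun ω => ((w a : ℂ) * w b) *
      (Z ω a k * star (Z ω a m) * Z ω b n * star (Z ω b k))) μ := fun a b =>
    (((((hZ a k).mul (hZ a m).star).mul (hZ b n)).mul (hZ b k).star).const_mul _).integrable
  simp only [heq]
  rw [integral_finsetSum _ fun i _ => integrable_finsetSum _ fun j _ => hint i j]
  have hin : ∀ a, ∫ ω, ∑ b, ((w a : ℂ) * w b) *
      (Z ω a k * star (Z ω a m) * Z ω b n * star (Z ω b k)) ∂μ =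
      ∑ b, ((w a : ℂ) * w b) * (β k * β n * ((if k = m ∧ n = k then 1 else 0) +
        if a = b ∧ m = n then 1 else 0)) := by
    intro a
    rw [integral_finsetSum _ fun j _ => hint a j]
    refine Finset.sum_congr rfl fun b _ => ?_
    rw [integral_const_mul, h.integral_four_entries]
    congr 4
    · simp
    · refine propext ⟨fun H => ⟨H.1.1, H.2.2.symm⟩, fun H => ⟨⟨H.1, rfl⟩, H.1.symm, H.2.symm⟩⟩
  simp only [hin, mul_add, Finset.sum_add_distrib]
  by_cases hmn : m = n
  · subst hmn
    simp only [and_true, if_true]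
    rw [add_comm]
    push_cast
    congr 1
    · simp only [mul_ite, mul_one, mul_zero, Finset.sum_ite_eq, Finset.mem_univ, if_true,
        Finset.sum_mul]
      exact Finset.sum_congr rfl fun a _ => by ring
    · by_cases hk : k = m
      · subst hk
        simp only [and_self, if_true, mul_one]
        push_cast
        simp only [sq, Finset.sum_mul, Finset.mul_sum]
        exact Finset.sum_congr rfl fun a _ => Finset.sum_congr rfl fun b _ => by ring
      · simp [hk]
  · have : ¬(k = m ∧ n = k) := fun H => hmn (H.1.symm.trans H.2.symm)
    simp [hmn, this]

end IsGaussianMatrix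

/-! ### Deterministic parameters and the algebra of the closed form. -/

noncomputable section

namespace RelayParams

variable {K : ℕ}

theorem α_pos (P : RelayParams K) : 0 < P.α := by
  have := P.ρ_lt_one
  unfold α
  linarith

/-- The diagonal of `Λ`: the gains of the converters. -/
def gain (P : RelayParams K) (M₀ M₁ : ℕ) : Antenna M₀ M₁ → ℝ :=
  Sum.elim (fun _ => 1) fun _ => P.α

theorem sum_gain (P : RelayParams K) (M₀ M₁ : ℕ) : ∑ a, P.gain M₀ M₁ a = P.N₁ M₀ M₁ := by
  simp [gain, N₁, Fintype.sum_sum_type, mul_comm]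

theorem sum_gain_sq (P : RelayParams K) (M₀ M₁ : ℕ) :
    ∑ a, P.gain M₀ M₁ a ^ 2 = P.N₂ M₀ M₁ := by
  simp [gain, N₂, Fintype.sum_sum_type, mul_comm]

theorem gain_cast (P : RelayParams K) (M₀ M₁ : ℕ) (a : Antenna M₀ M₁) :
    ((P.gain M₀ M₁ a : ℝ) : ℂ) = Sum.elim (fun _ => 1) (fun _ => (P.α : ℂ)) a := by
  rcases a with a | a <;> simp [gain]

/-- The power of the `m`-th output of the filter matched to `G_SR`. -/
def matchedPower (P : RelayParams K) (M₀ M₁ : ℕ) (m : Fin K) : ℝ :=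
  P.N₁ M₀ M₁ * P.βSR m * (P.sumpβ + 1 + P.N₁ M₀ M₁ * P.pS m * P.βSR m) +
    P.α * P.ρ * M₁ * (P.pS m * P.βSR m ^ 2)

theorem sum_βRD_mul_matchedPower (P : RelayParams K) (M₀ M₁ : ℕ) :
    ∑ m, P.βRD m * P.matchedPower M₀ M₁ m = P.entryPower M₀ M₁ := by
  simp only [matchedPower, entryPower, Finset.mul_sum, ← Finset.sum_add_distrib]
  exact Finset.sum_congr rfl fun m _ => by ring

theorem N₁_pos (P : RelayParams K) {M₀ M₁ : ℕ} (hM : 0 < M₀ + M₁) : 0 < P.N₁ M₀ M₁ := by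
  have hα := P.α_pos
  unfold N₁
  rcases Nat.eq_zero_or_pos M₀ with h | h
  · have : (0 : ℝ) < M₁ := by exact_mod_cast (by omega : 0 < M₁)
    positivity
  · have : (0 : ℝ) < M₀ := by exact_mod_cast h
    positivity

theorem sumpβ_nonneg (P : RelayParams K) : 0 ≤ P.sumpβ :=
  Finset.sum_nonneg fun i _ => mul_nonneg (P.pS_nonneg i) (P.βSR_pos i).le

/-- Needed to cancel the normalization of the relay power. The user `k` only ensures that the sum is
not empty. -/
theorem entryPower_pos (P : RelayParams K) {M₀ M₁ : ℕ} (hM : 0 < M₀ + M₁) (k : Fin K) :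
    0 < P.entryPower M₀ M₁ := by
  have h1 := P.N₁_pos hM
  have hα := P.α_pos
  have hρ := P.ρ_nonneg
  have hπ := P.sumpβ_nonneg
  rw [← sum_βRD_mul_matchedPower]
  refine Finset.sum_pos (fun m _ => ?_) ⟨k, Finset.mem_univ k⟩
  have hp := P.pS_nonneg m
  have hs := P.βSR_pos m
  have hr := P.βRD_pos m
  unfold matchedPower
  positivity

/-- The power of the signal received by a destination, split into the terms of the rate formula. -/
theorem received_power_eq (P : RelayParams K) (M₀ M₁ : ℕ) (γ : ℝ) (k : Fin K) :
    γ ^ 2 * (∑ m, (P.N₂ M₀ M₁ * P.βRD k * P.βRD m +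
        if k = m then P.N₁ M₀ M₁ ^ 2 * P.βRD k ^ 2 else 0) * P.matchedPower M₀ M₁ m +
      (1 - P.ρ) * P.ρ * M₁ * ∑ m, (P.βRD k * P.βRD m + if k = m then P.βRD k ^ 2 else 0) *
        P.matchedPower M₀ M₁ m) + 1 =
      P.termA M₀ M₁ γ k + (P.termB M₀ M₁ γ k + P.termC M₀ M₁ γ k + P.termD M₀ M₁ γ k +
        P.termE M₀ M₁ γ k + P.termF M₀ M₁ γ k + P.termG M₀ M₁ γ k + 1) := by
  have hα : P.α = 1 - P.ρ := rfl
  -- Every sum over users reduces to θ, `sumpβ` and `sumββ`. Once the sum over i ≠ k is completed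
  -- and its missing term subtracted, the claim is a polynomial identity.
  obtain ⟨θ, hθ⟩ : ∃ θ, θ = ∑ i, P.pS i * P.βSR i ^ 2 * P.βRD i := ⟨_, rfl⟩
  have hC : ∀ a b c : ℝ, ∑ i ∈ Finset.univ.erase k, P.pS i *
      (a * (b * P.βSR i + P.βRD k * P.βSR i ^ 2 * P.βRD i) + c * P.βSR i * P.sumββ) =
      a * (b * P.sumpβ + P.βRD k * θ) + c * P.sumpβ * P.sumββ - P.pS k *
      (a * (b * P.βSR k + P.βRD k * P.βSR k ^ 2 * P.βRD k) + c * P.βSR k * P.sumββ) := by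
    intro a b c
    rw [Finset.sum_erase_eq_sub (Finset.mem_univ k)]
    congr 1
    have hi : ∀ i, P.pS i *
        (a * (b * P.βSR i + P.βRD k * P.βSR i ^ 2 * P.βRD i) + c * P.βSR i * P.sumββ) =
        (a * b + c * P.sumββ) * (P.pS i * P.βSR i) +
          a * P.βRD k * (P.pS i * P.βSR i ^ 2 * P.βRD i) := fun i => by ring
    rw [Finset.sum_congr rfl fun i _ => hi i, Finset.sum_add_distrib, ← Finset.mul_sum,
      ← Finset.mul_sum, ← hθ, ← sumpβ]
    ring
  have hF : ∑ m, P.βSR m * P.βRD m * (P.sumpβ + P.pS m * P.βSR m + 1) =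
      P.sumββ * (P.sumpβ + 1) + θ := by
    rw [hθ]
    simp only [sumββ, Finset.sum_mul, ← Finset.sum_add_distrib]
    exact Finset.sum_congr rfl fun m _ => by ring
  have hG : ∑ m, P.βSR m * P.βRD m * (P.sumpβ + 1 + P.N₁ M₀ M₁ * P.pS m * P.βSR m) =
      P.sumββ * (P.sumpβ + 1) + P.N₁ M₀ M₁ * θ := by
    rw [hθ]
    simp only [sumββ, Finset.sum_mul, Finset.mul_sum, ← Finset.sum_add_distrib]
    exact Finset.sum_congr rfl fun m _ => by ring
  have hS : ∀ a b : ℝ, ∑ m, (a * P.βRD m + if k = m then b else 0) * P.matchedPower M₀ M₁ m =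
      a * P.entryPower M₀ M₁ + b * P.matchedPower M₀ M₁ k := by
    intro a b
    rw [← sum_βRD_mul_matchedPower]
    simp [add_mul, Finset.sum_add_distrib, Finset.mul_sum, mul_assoc, ite_mul]
  have hC' : P.termC M₀ M₁ γ k = γ ^ 2 * P.N₂ M₀ M₁ *
      (P.N₁ M₀ M₁ ^ 2 * (P.βSR k * P.βRD k ^ 2 * P.sumpβ + P.βRD k * θ) +
        P.N₂ M₀ M₁ * P.βRD k * P.sumpβ * P.sumββ - P.pS k *
      (P.N₁ M₀ M₁ ^ 2 * (P.βSR k * P.βRD k ^ 2 * P.βSR k + P.βRD k * P.βSR k ^ 2 * P.βRD k) +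
        P.N₂ M₀ M₁ * P.βRD k * P.βSR k * P.sumββ)) := by
    rw [termC, hC]
  rw [hS, hS, hC', entryPower, hG]
  simp only [termA, termB, termD, termE, termF, termG, matchedPower, hF, hG]
  have h3 : ∑ m, P.pS m * P.βSR m ^ 2 * P.βRD m = θ := hθ.symm
  rw [h3]
  simp only [N₁, N₂, hα]
  ring

end RelayParams

end

/-! ### Expansion of the signals over the primitive sources of randomness. -/

noncomputable section

namespace RelaySignals

section Coefficients

variable {Ω : Type*} {K M₀ M₁ : ℕ}

/-- The sigma-algebra generated by the Gaussian inputs with labels in `S`. -/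
@[reducible]
def inputSigma (X : RelaySignals Ω K M₀ M₁) (S : Set (Label K M₀ M₁)) : MeasurableSpace Ω :=
  ⨆ s ∈ S, MeasurableSpace.comap (X.gaussianInput s) inferInstance

/-- The labels of the entries of `G_SR`. -/
def srLabels (K M₀ M₁ : ℕ) : Set (Label K M₀ M₁) := Set.range Sum.inl

/-- The labels of the entries of `G_RD`. -/
def rdLabels (K M₀ M₁ : ℕ) : Set (Label K M₀ M₁) := Set.range fun q => Sum.inr (Sum.inl q)

/-- The labels of the symbols and of the thermal noise. -/
def signalLabels (K M₀ M₁ : ℕ) : Set (Label K M₀ M₁) := Set.range fun q => Sum.inr (Sum.inr q)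

theorem measurable_gaussianInput (X : RelaySignals Ω K M₀ M₁) {S : Set (Label K M₀ M₁)}
    {s : Label K M₀ M₁} (hs : s ∈ S) : Measurable[X.inputSigma S] (X.gaussianInput s) :=
  Measurable.of_comap_le (le_iSup₂ (f := fun s (_ : s ∈ S) =>
    MeasurableSpace.comap (X.gaussianInput s) inferInstance) s hs)

theorem measurable_channel (X : RelaySignals Ω K M₀ M₁)
    (s : (Antenna M₀ M₁ × Fin K) ⊕ (Antenna M₀ M₁ × Fin K)) :
    Measurable[X.channelSigma] fun ω =>
      Sum.elim (fun q => X.GSR ω q.1 q.2) (fun q => X.GRD ω q.1 q.2) s := by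
  let _ := X.channelSigma
  exact measurable_pi_iff.1 (comap_measurable fun ω s =>
    Sum.elim (fun q => X.GSR ω q.1 q.2) (fun q => X.GRD ω q.1 q.2) s) s

theorem channelSigma_le_inputSigma (X : RelaySignals Ω K M₀ M₁) :
    X.channelSigma ≤ X.inputSigma (srLabels K M₀ M₁ ∪ rdLabels K M₀ M₁) := by
  let _ := X.inputSigma (srLabels K M₀ M₁ ∪ rdLabels K M₀ M₁)
  refine Measurable.comap_le (measurable_pi_iff.2 ?_)
  rintro (q | q)
  · exact X.measurable_gaussianInput (s := Sum.inl q) (Or.inl ⟨q, rfl⟩)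
  · exact X.measurable_gaussianInput (s := Sum.inr (Sum.inl q)) (Or.inr ⟨q, rfl⟩)

theorem inputSigma_srLabels_le (X : RelaySignals Ω K M₀ M₁) :
    X.inputSigma (srLabels K M₀ M₁) ≤ X.channelSigma := by
  refine iSup₂_le ?_
  rintro _ ⟨q, rfl⟩
  exact (X.measurable_channel (Sum.inl q)).comap_le

theorem inputSigma_rdLabels_le (X : RelaySignals Ω K M₀ M₁) :
    X.inputSigma (rdLabels K M₀ M₁) ≤ X.channelSigma := by
  refine iSup₂_le ?_
  rintro _ ⟨q, rfl⟩
  exact (X.measurable_channel (Sum.inr q)).comap_le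

/-- Indices of the symbols and of the thermal noise. -/
abbrev ThermalIndex (K M₀ M₁ : ℕ) : Type := Fin K ⊕ Antenna M₀ M₁ ⊕ Fin K

/-- Indices of the symbols, of the thermal noise and of the noise of the ADCs. -/
abbrev ReceiveIndex (K M₀ M₁ : ℕ) : Type := ThermalIndex K M₀ M₁ ⊕ Fin M₁

/-- The symbols and the thermal noise. -/
def thermalSignal (X : RelaySignals Ω K M₀ M₁) (j : ThermalIndex K M₀ M₁) (ω : Ω) : ℂ :=
  X.gaussianInput (Sum.inr (Sum.inr j)) ω

/-- The symbols, the thermal noise and the noise of the ADCs. -/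
def receiveSignal (X : RelaySignals Ω K M₀ M₁) : ReceiveIndex K M₀ M₁ → Ω → ℂ :=
  Sum.elim X.thermalSignal fun a ω => X.nqA ω a

/-- The conditional power of the signal received by an antenna. -/
def antennaPower (X : RelaySignals Ω K M₀ M₁) (P : RelayParams K) (a : Antenna M₀ M₁) (ω : Ω) :
    ℝ :=
  ∑ i, P.pS i * ‖X.GSR ω a i‖ ^ 2 + 1

/-- The conditional powers of `receiveSignal`. -/
def receiveVar (X : RelaySignals Ω K M₀ M₁) (P : RelayParams K) : ReceiveIndex K M₀ M₁ → Ω → ℝ :=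
  Sum.elim (fun _ _ => 1) fun a ω => (1 - P.ρ) * P.ρ * X.antennaPower P (Sum.inr a) ω

/-- The coefficients of `y_R` in terms of the symbols and of the thermal noise. -/
def antennaCoef (X : RelaySignals Ω K M₀ M₁) (P : RelayParams K) (a : Antenna M₀ M₁) :
    ThermalIndex K M₀ M₁ → Ω → ℂ
  | Sum.inl i => fun ω => (Real.sqrt (P.pS i) : ℂ) * X.GSR ω a i
  | Sum.inr (Sum.inl b) => fun _ => if a = b then 1 else 0
  | Sum.inr (Sum.inr _) => fun _ => 0

/-- The coefficients of the `m`-th output of the matched filter `G_SR^H ỹ_R`. -/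
def matchedCoef (X : RelaySignals Ω K M₀ M₁) (P : RelayParams K) (m : Fin K) :
    ReceiveIndex K M₀ M₁ → Ω → ℂ
  | Sum.inl (Sum.inl i) => fun ω =>
      (Real.sqrt (P.pS i) : ℂ) * weightedGram (P.gain M₀ M₁) X.GSR i m ω
  | Sum.inl (Sum.inr (Sum.inl b)) => fun ω => (P.gain M₀ M₁ b : ℂ) * star (X.GSR ω b m)
  | Sum.inl (Sum.inr (Sum.inr _)) => fun _ => 0
  | Sum.inr a => fun ω => star (X.GSR ω (Sum.inr a) m)

/-- The coefficients of `x_R`. -/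
def relayCoef (X : RelaySignals Ω K M₀ M₁) (P : RelayParams K) (a : Antenna M₀ M₁)
    (j : ReceiveIndex K M₀ M₁) (ω : Ω) : ℂ :=
  ∑ m, star (X.GRD ω a m) * X.matchedCoef P m j ω

/-- The conditional power of an entry of `x_R`. -/
def relayPower (X : RelaySignals Ω K M₀ M₁) (P : RelayParams K) (a : Antenna M₀ M₁) (ω : Ω) :
    ℝ :=
  ∑ j, ‖X.relayCoef P a j ω‖ ^ 2 * X.receiveVar P j ω

/-- All the signals: symbols, thermal noise and both quantization noises. -/
def allSignal (X : RelaySignals Ω K M₀ M₁) : ReceiveIndex K M₀ M₁ ⊕ Fin M₁ → Ω → ℂ :=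
  Sum.elim X.receiveSignal fun a ω => X.nqD ω a

/-- The conditional powers of `allSignal`. -/
def allVar (X : RelaySignals Ω K M₀ M₁) (P : RelayParams K) :
    ReceiveIndex K M₀ M₁ ⊕ Fin M₁ → Ω → ℝ :=
  Sum.elim (X.receiveVar P) fun a ω => (1 - P.ρ) * P.ρ * X.relayPower P (Sum.inr a) ω

/-- The coefficients of the transmitted vector `x̃_R`. -/
def transmitCoef (X : RelaySignals Ω K M₀ M₁) (P : RelayParams K) (a : Antenna M₀ M₁) :
    ReceiveIndex K M₀ M₁ ⊕ Fin M₁ → Ω → ℂ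
  | Sum.inl j => fun ω => (P.gain M₀ M₁ a : ℂ) * X.relayCoef P a j ω
  | Sum.inr b => fun _ => if a = Sum.inr b then 1 else 0

/-- The index of the symbol `x_S,k`. -/
def symbolIndex (k : Fin K) : ReceiveIndex K M₀ M₁ ⊕ Fin M₁ := Sum.inl (Sum.inl (Sum.inl k))

/-- The index of the noise `n_D,k`. -/
def destNoiseIndex (k : Fin K) : ReceiveIndex K M₀ M₁ := Sum.inl (Sum.inr (Sum.inr k))

/-- The coefficients of `y_D,k` for the normalization factor `g`. -/
def destCoef (X : RelaySignals Ω K M₀ M₁) (P : RelayParams K) (g : ℝ) (k : Fin K) :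
    ReceiveIndex K M₀ M₁ ⊕ Fin M₁ → Ω → ℂ
  | Sum.inl j => fun ω => (g : ℂ) * (∑ m, weightedGram (P.gain M₀ M₁) X.GRD k m ω *
      X.matchedCoef P m j ω) + if j = destNoiseIndex k then 1 else 0
  | Sum.inr b => fun ω => (g : ℂ) * X.GRD ω (Sum.inr b) k

theorem yR_eq_sum (X : RelaySignals Ω K M₀ M₁) (P : RelayParams K) (a : Antenna M₀ M₁) (ω : Ω) :
    X.yR P ω a = ∑ j, X.antennaCoef P a j ω * X.thermalSignal j ω := by
  simp only [Fintype.sum_sum_type (α₁ := Fin K), Fintype.sum_sum_type (α₂ := Fin K), antennaCoef,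
    thermalSignal, gaussianInput, yR, Pi.add_apply, Matrix.mulVec, dotProduct, ite_mul, one_mul,
    zero_mul, Finset.sum_ite_eq, Finset.mem_univ, if_true, Finset.sum_const_zero, add_zero]
  congr 1
  exact Finset.sum_congr rfl fun i _ => by ring

theorem yRq_eq (X : RelaySignals Ω K M₀ M₁) (P : RelayParams K) (a : Antenna M₀ M₁) (ω : Ω) :
    X.yRq P ω a = (P.gain M₀ M₁ a : ℂ) * X.yR P ω a +
      ∑ b, (if a = Sum.inr b then 1 else 0) * X.nqA ω b := by
  rcases a with a | a <;> simp [yRq, RelayParams.gain]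

theorem xRq_eq (X : RelaySignals Ω K M₀ M₁) (P : RelayParams K) (a : Antenna M₀ M₁) (ω : Ω) :
    X.xRq P ω a = (P.gain M₀ M₁ a : ℂ) * X.xR P ω a +
      ∑ b, (if a = Sum.inr b then 1 else 0) * X.nqD ω b := by
  rcases a with a | a <;> simp [xRq, RelayParams.gain]

/-- This isolates the part of the relay processing that depends on `GSR` alone; what follows the
matched filter brings in `GRD` and the DAC noise. -/
theorem matched_eq_sum (X : RelaySignals Ω K M₀ M₁) (P : RelayParams K) (m : Fin K) (ω : Ω) :
    ((X.GSR ω)ᴴ *ᵥ X.yRq P ω) m = ∑ j, X.matchedCoef P m j ω * X.receiveSignal j ω := by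
  have h1 : ∑ a, star (X.GSR ω a m) * ∑ b, (if a = Sum.inr b then 1 else 0) * X.nqA ω b =
      ∑ b, star (X.GSR ω (Sum.inr b) m) * X.nqA ω b := by
    simp [Fintype.sum_sum_type]
  have h2 : ∑ a, star (X.GSR ω a m) * ((P.gain M₀ M₁ a : ℂ) * X.yR P ω a) =
      ∑ i, (Real.sqrt (P.pS i) : ℂ) * weightedGram (P.gain M₀ M₁) X.GSR i m ω * X.xS ω i +
        ∑ b, (P.gain M₀ M₁ b : ℂ) * star (X.GSR ω b m) * X.nR ω b := by
    simp only [yR, Pi.add_apply, Matrix.mulVec, dotProduct, mul_add, Finset.sum_add_distrib,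
      weightedGram, Finset.mul_sum, Finset.sum_mul]
    rw [Finset.sum_comm]
    congr 1
    · exact Finset.sum_congr rfl fun i _ => Finset.sum_congr rfl fun a _ => by ring
    · exact Finset.sum_congr rfl fun a _ => by ring
  have h3 : ((X.GSR ω)ᴴ *ᵥ X.yRq P ω) m = ∑ a, star (X.GSR ω a m) * X.yRq P ω a := rfl
  rw [h3]
  simp only [yRq_eq, mul_add, Finset.sum_add_distrib, h1, h2]
  simp only [Fintype.sum_sum_type (α₁ := Fin K), Fintype.sum_sum_type (α₂ := Fin K),
    Fintype.sum_sum_type (α₂ := Fin M₁) (α₁ := ThermalIndex K M₀ M₁), matchedCoef, receiveSignal,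
    thermalSignal, gaussianInput, Sum.elim_inl, Sum.elim_inr, zero_mul, Finset.sum_const_zero,
    add_zero]

theorem xR_eq_sum_matched (X : RelaySignals Ω K M₀ M₁) (P : RelayParams K) (a : Antenna M₀ M₁)
    (ω : Ω) : X.xR P ω a = ∑ m, star (X.GRD ω a m) * ((X.GSR ω)ᴴ *ᵥ X.yRq P ω) m := by
  unfold xR W
  rw [← Matrix.mulVec_mulVec]
  rfl

theorem xR_eq_sum (X : RelaySignals Ω K M₀ M₁) (P : RelayParams K) (a : Antenna M₀ M₁) (ω : Ω) :
    X.xR P ω a = ∑ j, X.relayCoef P a j ω * X.receiveSignal j ω := by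
  simp only [xR_eq_sum_matched, matched_eq_sum, relayCoef, Finset.mul_sum, Finset.sum_mul]
  rw [Finset.sum_comm]
  exact Finset.sum_congr rfl fun i _ => Finset.sum_congr rfl fun a _ => by ring

theorem xRq_eq_sum (X : RelaySignals Ω K M₀ M₁) (P : RelayParams K) (a : Antenna M₀ M₁) (ω : Ω) :
    X.xRq P ω a = ∑ j, X.transmitCoef P a j ω * X.allSignal j ω := by
  rw [xRq_eq, xR_eq_sum, Fintype.sum_sum_type (α₁ := ReceiveIndex K M₀ M₁),
    Finset.mul_sum]
  simp only [transmitCoef, allSignal, Sum.elim_inl, Sum.elim_inr, mul_assoc]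

/-- The destination noise belongs to the same family as the relay signals, with matched filter
coefficient zero, so its only contribution to `yD` is the Kronecker delta in `destCoef`. -/
theorem yD_eq_sum [MeasurableSpace Ω] (X : RelaySignals Ω K M₀ M₁) (P : RelayParams K)
    (μ : Measure Ω) (k : Fin K) (ω : Ω) :
    X.yD P μ k ω = ∑ j, X.destCoef P (X.γ P μ) k j ω * X.allSignal j ω := by
  have h1 : ((X.GRD ω)ᵀ *ᵥ X.xRq P ω) k =
      (∑ j, (∑ m, weightedGram (P.gain M₀ M₁) X.GRD k m ω * X.matchedCoef P m j ω) *
        X.receiveSignal j ω) + ∑ b, X.GRD ω (Sum.inr b) k * X.nqD ω b := by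
    have h2 : ((X.GRD ω)ᵀ *ᵥ X.xRq P ω) k = ∑ a, X.GRD ω a k * X.xRq P ω a := rfl
    have h3 : ∑ a, X.GRD ω a k * ∑ b, (if a = Sum.inr b then 1 else 0) * X.nqD ω b =
        ∑ b, X.GRD ω (Sum.inr b) k * X.nqD ω b := by
      simp [Fintype.sum_sum_type]
    rw [h2]
    simp only [xRq_eq, mul_add, Finset.sum_add_distrib, h3]
    congr 1
    have h4 : ∑ j, (∑ m, weightedGram (P.gain M₀ M₁) X.GRD k m ω * X.matchedCoef P m j ω) *
        X.receiveSignal j ω = ∑ m, weightedGram (P.gain M₀ M₁) X.GRD k m ω *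
          ((X.GSR ω)ᴴ *ᵥ X.yRq P ω) m := by
      simp only [matched_eq_sum, Finset.mul_sum, Finset.sum_mul]
      rw [Finset.sum_comm]
      exact Finset.sum_congr rfl fun i _ => Finset.sum_congr rfl fun a _ => by ring
    rw [h4]
    simp only [xR_eq_sum_matched, weightedGram, Finset.mul_sum, Finset.sum_mul]
    rw [Finset.sum_comm]
    exact Finset.sum_congr rfl fun i _ => Finset.sum_congr rfl fun a _ => by ring
  have h5 : ∑ j : ReceiveIndex K M₀ M₁, (if j = destNoiseIndex k then 1 else 0) *
      X.receiveSignal j ω = X.nD ω k := by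
    simp only [ite_mul, one_mul, zero_mul, Finset.sum_ite_eq', Finset.mem_univ, if_true]
    rfl
  rw [yD, h1, Fintype.sum_sum_type (α₁ := ReceiveIndex K M₀ M₁)]
  simp only [destCoef, allSignal, Sum.elim_inl, Sum.elim_inr, add_mul, Finset.sum_add_distrib, h5,
    mul_add, Finset.mul_sum, mul_assoc, Finset.sum_mul]
  ring

/-- Reassociating around `W` exhibits the channel as a product of two K × K weighted Gram matrices,
one for each hop. -/
theorem T_eq_sum [MeasurableSpace Ω] (X : RelaySignals Ω K M₀ M₁) (P : RelayParams K)
    (μ : Measure Ω) (i j : Fin K) (ω : Ω) :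
    X.T P μ i j ω = (X.γ P μ : ℂ) * ∑ m, weightedGram (P.gain M₀ M₁) X.GRD i m ω *
      weightedGram (P.gain M₀ M₁) X.GSR j m ω := by
  have hassoc : ∀ L : Matrix (Antenna M₀ M₁) (Antenna M₀ M₁) ℂ,
      (X.GRD ω)ᵀ * L * X.W ω * L * X.GSR ω =
        ((X.GRD ω)ᵀ * L * (X.GRD ω).map star) * ((X.GSR ω)ᴴ * L * X.GSR ω) := fun L => by
    simp only [W, Matrix.mul_assoc]
  simp only [T, hassoc]
  rw [Matrix.mul_apply]
  congr 1
  refine Finset.sum_congr rfl fun m _ => ?_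
  congr 1
  · rw [Matrix.mul_apply]
    refine Finset.sum_congr rfl fun a _ => ?_
    rw [Matrix.mul_diagonal, ← RelayParams.gain_cast, Matrix.transpose_apply, Matrix.map_apply]
    ring
  · rw [Matrix.mul_apply]
    refine Finset.sum_congr rfl fun a _ => ?_
    rw [Matrix.mul_diagonal, ← RelayParams.gain_cast, Matrix.conjTranspose_apply]
    ring

theorem antennaPower_cast (X : RelaySignals Ω K M₀ M₁) (P : RelayParams K) (a : Antenna M₀ M₁)
    (ω : Ω) : (X.antennaPower P a ω : ℂ) =
      ∑ i, (P.pS i : ℂ) * (X.GSR ω a i * star (X.GSR ω a i)) + 1 := by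
  simp only [antennaPower, mul_star_eq_normSq_cast]
  push_cast
  rfl

theorem antennaPower_nonneg (X : RelaySignals Ω K M₀ M₁) (P : RelayParams K)
    (a : Antenna M₀ M₁) (ω : Ω) : 0 ≤ X.antennaPower P a ω :=
  add_nonneg (Finset.sum_nonneg fun i _ => mul_nonneg (P.pS_nonneg i) (sq_nonneg _)) zero_le_one

theorem relayPower_cast (X : RelaySignals Ω K M₀ M₁) (P : RelayParams K) (a : Antenna M₀ M₁)
    (ω : Ω) : (X.relayPower P a ω : ℂ) =
      ∑ j, X.relayCoef P a j ω * star (X.relayCoef P a j ω) * X.receiveVar P j ω := by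
  simp only [relayPower, mul_star_eq_normSq_cast]
  push_cast
  rfl

end Coefficients

end RelaySignals

end

/-! ### Independence, moments and second-order statistics under the model. -/

noncomputable section

namespace IsRelayModel

variable {Ω : Type*} [mΩ : MeasurableSpace Ω] {μ : Measure Ω} {K M₀ M₁ : ℕ}
  {P : RelayParams K} {X : RelaySignals Ω K M₀ M₁}

open RelaySignals

theorem isGaussianFamily (hX : IsRelayModel μ P X) :
    IsGaussianFamily μ X.gaussianInput (P.inputVariance M₀ M₁) where
  measurable := hX.measurable_input
  map_eq := hX.map_input
  indep := hX.indep_input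
  nonneg := by
    rintro (q | q | q)
    exacts [(P.βSR_pos _).le, (P.βRD_pos _).le, zero_le_one]

theorem isGaussianMatrix_GSR (hX : IsRelayModel μ P X) : IsGaussianMatrix μ X.GSR P.βSR where
  measurable q := hX.measurable_input (Sum.inl q)
  map_eq q := hX.map_input (Sum.inl q)
  indep := hX.indep_input.precomp (g := fun q => Sum.inl q) Sum.inl_injective
  nonneg _ := (P.βSR_pos _).le

theorem isGaussianMatrix_GRD (hX : IsRelayModel μ P X) : IsGaussianMatrix μ X.GRD P.βRD where
  measurable q := hX.measurable_input (Sum.inr (Sum.inl q))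
  map_eq q := hX.map_input (Sum.inr (Sum.inl q))
  indep := hX.indep_input.precomp (g := fun q => Sum.inr (Sum.inl q))
    (Sum.inr_injective.comp Sum.inl_injective)
  nonneg _ := (P.βRD_pos _).le

theorem inputSigma_le (hX : IsRelayModel μ P X) (S : Set (Label K M₀ M₁)) :
    X.inputSigma S ≤ mΩ :=
  iSup₂_le fun s _ => (hX.measurable_input s).comap_le

theorem channelSigma_le (hX : IsRelayModel μ P X) : X.channelSigma ≤ mΩ :=
  X.channelSigma_le_inputSigma.trans (hX.inputSigma_le _)

theorem indep_inputSigma (hX : IsRelayModel μ P X) {S T : Set (Label K M₀ M₁)}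
    (hST : Disjoint S T) : Indep (X.inputSigma S) (X.inputSigma T) μ :=
  indep_iSup_of_disjoint (fun s => (hX.measurable_input s).comap_le) hX.indep_input hST

theorem indep_rd_sr (hX : IsRelayModel μ P X) :
    Indep (X.inputSigma (rdLabels K M₀ M₁)) (X.inputSigma (srLabels K M₀ M₁)) μ := by
  refine hX.indep_inputSigma (Set.disjoint_left.2 ?_)
  rintro _ ⟨q, rfl⟩ ⟨r, hr⟩
  simp at hr

theorem indep_signal_channel (hX : IsRelayModel μ P X) :
    Indep (X.inputSigma (signalLabels K M₀ M₁)) X.channelSigma μ := by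
  refine indep_of_indep_of_le_right (hX.indep_inputSigma (Set.disjoint_left.2 ?_))
    X.channelSigma_le_inputSigma
  rintro _ ⟨q, rfl⟩ (⟨r, hr⟩ | ⟨r, hr⟩) <;> simp at hr

theorem hasMoments_GSR (hX : IsRelayModel μ P X) (a : Antenna M₀ M₁) (k : Fin K) :
    HasMoments (X.inputSigma (srLabels K M₀ M₁)) μ fun ω => X.GSR ω a k :=
  IsGaussianFamily.hasMoments _ hX.isGaussianFamily (Sum.inl (a, k))
    (X.measurable_gaussianInput ⟨_, rfl⟩)

theorem hasMoments_GRD (hX : IsRelayModel μ P X) (a : Antenna M₀ M₁) (k : Fin K) :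
    HasMoments (X.inputSigma (rdLabels K M₀ M₁)) μ fun ω => X.GRD ω a k :=
  IsGaussianFamily.hasMoments _ hX.isGaussianFamily (Sum.inr (Sum.inl (a, k)))
    (X.measurable_gaussianInput ⟨_, rfl⟩)

variable [IsProbabilityMeasure μ]

theorem hasMoments_antennaPower (hX : IsRelayModel μ P X) (a : Antenna M₀ M₁) :
    HasMoments (X.inputSigma (srLabels K M₀ M₁)) μ fun ω => (X.antennaPower P a ω : ℂ) := by
  simp only [antennaPower_cast]
  exact (HasMoments.sum _ fun i =>
    ((hX.hasMoments_GSR a i).mul (hX.hasMoments_GSR a i).star).const_mul _).add (HasMoments.const 1)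

theorem hasMoments_receiveVar (hX : IsRelayModel μ P X) (j : ReceiveIndex K M₀ M₁) :
    HasMoments (X.inputSigma (srLabels K M₀ M₁)) μ fun ω => (X.receiveVar P j ω : ℂ) := by
  rcases j with j | a
  · exact HasMoments.const ((1 : ℝ) : ℂ)
  · simp only [receiveVar, Sum.elim_inr, Complex.ofReal_mul]
    exact (hX.hasMoments_antennaPower _).const_mul _

theorem hasMoments_matchedCoef (hX : IsRelayModel μ P X) (m : Fin K) (j : ReceiveIndex K M₀ M₁) :
    HasMoments (X.inputSigma (srLabels K M₀ M₁)) μ (X.matchedCoef P m j) := by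
  rcases j with (i | b | i) | a
  · exact (hasMoments_weightedGram hX.hasMoments_GSR _ _ _).const_mul _
  · exact (hX.hasMoments_GSR b m).star.const_mul _
  · exact HasMoments.const 0
  · exact (hX.hasMoments_GSR (Sum.inr a) m).star

theorem hasMoments_antennaCoef (hX : IsRelayModel μ P X) (a : Antenna M₀ M₁)
    (j : ThermalIndex K M₀ M₁) : HasMoments X.channelSigma μ (X.antennaCoef P a j) := by
  rcases j with i | b | i
  · exact ((hX.hasMoments_GSR a i).mono X.inputSigma_srLabels_le).const_mul _
  · exact HasMoments.const _
  · exact HasMoments.const 0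

theorem hasMoments_relayCoef (hX : IsRelayModel μ P X) (a : Antenna M₀ M₁)
    (j : ReceiveIndex K M₀ M₁) : HasMoments X.channelSigma μ (X.relayCoef P a j) :=
  HasMoments.sum _ fun m => ((hX.hasMoments_GRD a m).mono X.inputSigma_rdLabels_le).star.mul
    ((hX.hasMoments_matchedCoef m j).mono X.inputSigma_srLabels_le)

theorem hasMoments_relayPower (hX : IsRelayModel μ P X) (a : Antenna M₀ M₁) :
    HasMoments X.channelSigma μ fun ω => (X.relayPower P a ω : ℂ) := by
  simp only [relayPower_cast]
  exact HasMoments.sum _ fun j => ((hX.hasMoments_relayCoef a j).mul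
    (hX.hasMoments_relayCoef a j).star).mul
      ((hX.hasMoments_receiveVar j).mono X.inputSigma_srLabels_le)

theorem hasMoments_transmitCoef (hX : IsRelayModel μ P X) (a : Antenna M₀ M₁)
    (j : ReceiveIndex K M₀ M₁ ⊕ Fin M₁) :
    HasMoments X.channelSigma μ (X.transmitCoef P a j) := by
  rcases j with j | b
  · exact (hX.hasMoments_relayCoef a j).const_mul _
  · exact HasMoments.const _

theorem hasMoments_destCoef (hX : IsRelayModel μ P X) (g : ℝ) (k : Fin K)
    (j : ReceiveIndex K M₀ M₁ ⊕ Fin M₁) :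
    HasMoments X.channelSigma μ (X.destCoef P g k j) := by
  rcases j with j | b
  · exact ((HasMoments.sum _ fun m =>
      ((hasMoments_weightedGram hX.hasMoments_GRD _ _ _).mono X.inputSigma_rdLabels_le).mul
      ((hX.hasMoments_matchedCoef m j).mono X.inputSigma_srLabels_le)).const_mul _).add
        (HasMoments.const _)
  · exact ((hX.hasMoments_GRD _ k).mono X.inputSigma_rdLabels_le).const_mul _

/-! ### Conditional orthogonality of the signals -/

/-- Symbols and thermal noise are independent of the channels, so conditional second moments equal
ordinary ones. -/
theorem isCondOrthogonal_thermal (hX : IsRelayModel μ P X) :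
    IsCondOrthogonal X.channelSigma μ X.thermalSignal fun _ _ => 1 := by
  have hcond : ∀ i j, μ[fun ω => X.thermalSignal i ω * star (X.thermalSignal j ω) |
      X.channelSigma] =ᵐ[μ] fun _ => if i = j then 1 else 0 := by
    intro i j
    have hmeas : ∀ i, Measurable[X.inputSigma (signalLabels K M₀ M₁)] (X.thermalSignal i) :=
      fun i => X.measurable_gaussianInput ⟨i, rfl⟩
    refine (condExp_indep_eq (hX.inputSigma_le _) hX.channelSigma_le
      (((hmeas i).mul (continuous_star.measurable.comp (hmeas j)))).stronglyMeasurable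
      hX.indep_signal_channel).trans (Filter.Eventually.of_forall fun _ => ?_)
    have := hX.isGaussianFamily.integral_mul_star (Sum.inr (Sum.inr i)) (Sum.inr (Sum.inr j))
    simpa [thermalSignal, RelayParams.inputVariance] using this
  exact
    { memLp := fun i => (IsGaussianFamily.hasMoments mΩ hX.isGaussianFamily _
        (hX.measurable_input _)).memLp 2 (by simp)
      nonneg := fun _ _ => zero_le_one
      hasMoments := fun _ => HasMoments.const _
      cross := fun i j hij => (hcond i j).trans (Filter.Eventually.of_forall fun _ => if_neg hij)
      diag := fun i => (hcond i i).trans (Filter.Eventually.of_forall fun _ => by simp) }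

theorem condExp_yR_mul_star (hX : IsRelayModel μ P X) (a : Antenna M₀ M₁) :
    μ[fun ω => X.yR P ω a * star (X.yR P ω a) | X.channelSigma] =ᵐ[μ]
      fun ω => (X.antennaPower P a ω : ℂ) := by
  simp only [yR_eq_sum]
  refine (hX.isCondOrthogonal_thermal.condExp_sum_mul_star_sum hX.channelSigma_le
    (hX.hasMoments_antennaCoef a) (hX.hasMoments_antennaCoef a)).trans
      (Filter.Eventually.of_forall fun ω => ?_)
  have hp : ∀ i, ((Real.sqrt (P.pS i) : ℝ) : ℂ) * (Real.sqrt (P.pS i) : ℝ) = P.pS i := fun i => by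
    rw [← Complex.ofReal_mul, Real.mul_self_sqrt (P.pS_nonneg i)]
  simp only [Fintype.sum_sum_type (α₁ := Fin K), Fintype.sum_sum_type (α₂ := Fin K), antennaCoef,
    antennaPower_cast, Complex.ofReal_one, mul_one, Complex.star_def, map_mul,
    Complex.conj_ofReal]
  congr 1
  · refine Finset.sum_congr rfl fun i _ => ?_
    rw [← hp i]
    ring
  · simp

/-- The family grows in two stages, since the conditional power of a DAC input can be computed only
once the ADC noise has joined. -/
theorem isCondOrthogonal_receive (hX : IsRelayModel μ P X) :
    IsCondOrthogonal X.channelSigma μ X.receiveSignal (X.receiveVar P) :=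
  hX.isCondOrthogonal_thermal.sumElim_noise P.ρ_nonneg P.ρ_lt_one.le hX.adc id
    (by rintro (i | i | i) ω <;> rfl) (fun a ω => antennaPower_nonneg X P _ ω)
    (fun a => (hX.hasMoments_antennaPower _).mono X.inputSigma_srLabels_le)
    fun a => hX.condExp_yR_mul_star _

theorem condExp_xR_mul_star (hX : IsRelayModel μ P X) (a : Antenna M₀ M₁) :
    μ[fun ω => X.xR P ω a * star (X.xR P ω a) | X.channelSigma] =ᵐ[μ]
      fun ω => (X.relayPower P a ω : ℂ) := by
  simp only [xR_eq_sum, relayPower_cast]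
  exact hX.isCondOrthogonal_receive.condExp_sum_mul_star_sum hX.channelSigma_le
    (hX.hasMoments_relayCoef a) (hX.hasMoments_relayCoef a)

theorem isCondOrthogonal_all (hX : IsRelayModel μ P X) :
    IsCondOrthogonal X.channelSigma μ X.allSignal (X.allVar P) := by
  refine hX.isCondOrthogonal_receive.sumElim_noise P.ρ_nonneg P.ρ_lt_one.le hX.dac
    -- Matches the nesting of `ReceiveIndex` with that of the signals listed in the `dac` field of
    -- the model.
    (Sum.elim (Sum.elim Sum.inl (Sum.elim (fun b => Sum.inr (Sum.inl b))
      fun i => Sum.inr (Sum.inr (Sum.inl i)))) fun a => Sum.inr (Sum.inr (Sum.inr a)))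
    (by rintro ((i | i | i) | a) ω <;> rfl)
    (fun a ω => Finset.sum_nonneg fun j _ => mul_nonneg (sq_nonneg _)
      (hX.isCondOrthogonal_receive.nonneg j ω))
    (fun a => hX.hasMoments_relayPower _) fun a => hX.condExp_xR_mul_star _

/-! ### Powers -/

/-- The fourth order moments of one row of `G_SR` that enter the power of the ADC noise. -/
theorem integral_entry_mul_antennaPower (hX : IsRelayModel μ P X) (a : Antenna M₀ M₁)
    (m : Fin K) :
    ∫ ω, star (X.GSR ω a m) * X.GSR ω a m * (X.antennaPower P a ω : ℂ) ∂μ =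
      ((P.βSR m * (P.sumpβ + P.pS m * P.βSR m + 1) : ℝ) : ℂ) := by
  have hH := hX.hasMoments_GSR
  have heq : ∀ ω, star (X.GSR ω a m) * X.GSR ω a m * (X.antennaPower P a ω : ℂ) =
      ∑ i, (P.pS i : ℂ) * (X.GSR ω a m * star (X.GSR ω a m) * X.GSR ω a i * star (X.GSR ω a i)) +
        X.GSR ω a m * star (X.GSR ω a m) := by
    intro ω
    rw [antennaPower_cast, mul_add, Finset.mul_sum]
    congr 1
    · exact Finset.sum_congr rfl fun i _ => by ring
    · ring
  have hint : ∀ i, Integrable (fun ω => (P.pS i : ℂ) *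
      (X.GSR ω a m * star (X.GSR ω a m) * X.GSR ω a i * star (X.GSR ω a i))) μ := fun i =>
    (((((hH a m).mul (hH a m).star).mul (hH a i)).mul (hH a i).star).const_mul _).integrable
  simp only [heq]
  rw [integral_add (integrable_finsetSum _ fun i _ => hint i)
    ((hH a m).mul (hH a m).star).integrable, integral_finsetSum _ fun i _ => hint i,
    hX.isGaussianMatrix_GSR.integral_entry_mul_star]
  have h1 : ∀ i, ∫ ω, (P.pS i : ℂ) *
      (X.GSR ω a m * star (X.GSR ω a m) * X.GSR ω a i * star (X.GSR ω a i)) ∂μ =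
      P.βSR m * (P.pS i * P.βSR i) + if m = i then P.βSR m * (P.pS m * P.βSR m : ℂ) else 0 := by
    intro i
    rw [integral_const_mul, hX.isGaussianMatrix_GSR.integral_four_entries]
    by_cases h : m = i
    · subst h
      simp only [and_self, if_true]
      ring
    · simp only [h, and_self, and_false, false_and, if_true, if_false]
      ring
  simp only [h1, Finset.sum_add_distrib, Finset.sum_ite_eq, Finset.mem_univ, if_true, and_self,
    ← Finset.mul_sum, RelayParams.sumpβ]
  push_cast
  ring

/-- The power of the `m`-th output of the matched filter. -/
theorem sum_integral_matchedCoef (hX : IsRelayModel μ P X) (m : Fin K) :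
    ∑ j, ∫ ω, X.matchedCoef P m j ω * star (X.matchedCoef P m j ω) * X.receiveVar P j ω ∂μ =
      (P.matchedPower M₀ M₁ m : ℂ) := by
  have hp : ∀ i, ((Real.sqrt (P.pS i) : ℝ) : ℂ) * (Real.sqrt (P.pS i) : ℝ) = P.pS i := fun i => by
    rw [← Complex.ofReal_mul, Real.mul_self_sqrt (P.pS_nonneg i)]
  have h1 : ∀ i, ∫ ω, ((Real.sqrt (P.pS i) : ℂ) * weightedGram (P.gain M₀ M₁) X.GSR i m ω) *
      star ((Real.sqrt (P.pS i) : ℂ) * weightedGram (P.gain M₀ M₁) X.GSR i m ω) * ((1 : ℝ) : ℂ) ∂μ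
      = ((P.N₂ M₀ M₁ * P.βSR m * (P.pS i * P.βSR i) +
        if i = m then P.pS m * P.N₁ M₀ M₁ ^ 2 * P.βSR m ^ 2 else 0 : ℝ) : ℂ) := by
    intro i
    have heq : ∀ ω, ((Real.sqrt (P.pS i) : ℂ) * weightedGram (P.gain M₀ M₁) X.GSR i m ω) *
      star ((Real.sqrt (P.pS i) : ℂ) * weightedGram (P.gain M₀ M₁) X.GSR i m ω) * ((1 : ℝ) : ℂ) =
      (P.pS i : ℂ) * (weightedGram (P.gain M₀ M₁) X.GSR i m ω *
        star (weightedGram (P.gain M₀ M₁) X.GSR i m ω)) := by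
      intro ω
      rw [star_mul', Complex.star_def, Complex.conj_ofReal, ← hp i]
      push_cast
      ring
    simp only [heq]
    rw [integral_const_mul, hX.isGaussianMatrix_GSR.integral_weightedGram_mul_star,
      P.sum_gain_sq, P.sum_gain, if_pos rfl, ← Complex.ofReal_mul]
    congr 1
    by_cases h : i = m
    · subst h
      simp only [if_true]
      ring
    · simp only [if_neg h]
      ring
  have h2 : ∀ b, ∫ ω, ((P.gain M₀ M₁ b : ℂ) * star (X.GSR ω b m)) *
      star ((P.gain M₀ M₁ b : ℂ) * star (X.GSR ω b m)) * ((1 : ℝ) : ℂ) ∂μ =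
      ((P.gain M₀ M₁ b ^ 2 * P.βSR m : ℝ) : ℂ) := by
    intro b
    have heq : ∀ ω, ((P.gain M₀ M₁ b : ℂ) * star (X.GSR ω b m)) *
      star ((P.gain M₀ M₁ b : ℂ) * star (X.GSR ω b m)) * ((1 : ℝ) : ℂ) =
      (P.gain M₀ M₁ b : ℂ) ^ 2 * (X.GSR ω b m * star (X.GSR ω b m)) := by
      intro ω
      rw [star_mul', star_star, Complex.star_def, Complex.conj_ofReal]
      push_cast
      ring
    simp only [heq]
    rw [integral_const_mul, hX.isGaussianMatrix_GSR.integral_entry_mul_star]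
    simp
  have h3 : ∀ a : Fin M₁, ∫ ω, star (X.GSR ω (Sum.inr a) m) * star (star (X.GSR ω (Sum.inr a) m)) *
      (((1 - P.ρ) * P.ρ * X.antennaPower P (Sum.inr a) ω : ℝ) : ℂ) ∂μ =
      (((1 - P.ρ) * P.ρ * (P.βSR m * (P.sumpβ + P.pS m * P.βSR m + 1)) : ℝ) : ℂ) := by
    intro a
    rw [Complex.ofReal_mul _ (P.βSR m * _), ← hX.integral_entry_mul_antennaPower (Sum.inr a) m,
      ← integral_const_mul]
    refine integral_congr_ae (Filter.Eventually.of_forall fun ω => ?_)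
    simp only [star_star, Complex.ofReal_mul]
    ring
  simp only [Fintype.sum_sum_type (α₁ := Fin K), Fintype.sum_sum_type (α₂ := Fin K),
    Fintype.sum_sum_type (α₂ := Fin M₁) (α₁ := ThermalIndex K M₀ M₁), matchedCoef, receiveVar,
    Sum.elim_inl, Sum.elim_inr, h1, h2, h3, zero_mul, integral_zero, Finset.sum_const_zero,
    add_zero]
  simp only [← Complex.ofReal_sum]
  rw [← Complex.ofReal_add, ← Complex.ofReal_add]
  congr 1
  rw [Finset.sum_add_distrib, ← Finset.mul_sum, ← Finset.sum_mul, P.sum_gain_sq,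
    ← RelayParams.sumpβ]
  simp only [Finset.sum_ite_eq', Finset.mem_univ, if_true, Finset.sum_const, Finset.card_univ,
    Fintype.card_fin, nsmul_eq_mul]
  -- Since α² + αρ = α, the ADC noise completes N₂ to N₁ in the terms that do not come from a fourth
  -- moment of a single entry.
  simp only [RelayParams.matchedPower, RelayParams.N₁, RelayParams.N₂, RelayParams.α]
  ring

/-- The power of a combination of the outputs of the matched filter with uncorrelated
coefficients that depend on `G_RD` only. -/
theorem sum_integral_combination (hX : IsRelayModel μ P X) {U : Fin K → Ω → ℂ} {a : Fin K → ℝ}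
    (hU : ∀ m, HasMoments (X.inputSigma (rdLabels K M₀ M₁)) μ (U m))
    (ha : ∀ m n, ∫ ω, U m ω * star (U n ω) ∂μ = if m = n then (a m : ℂ) else 0) :
    ∑ j, ∫ ω, (∑ m, U m ω * X.matchedCoef P m j ω) * star (∑ m, U m ω * X.matchedCoef P m j ω) *
      X.receiveVar P j ω ∂μ = ((∑ m, a m * P.matchedPower M₀ M₁ m : ℝ) : ℂ) := by
  have h : ∀ j, ∫ ω, (∑ m, U m ω * X.matchedCoef P m j ω) *
      star (∑ m, U m ω * X.matchedCoef P m j ω) * X.receiveVar P j ω ∂μ =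
      ∑ m, (a m : ℂ) * ∫ ω, X.matchedCoef P m j ω * star (X.matchedCoef P m j ω) *
        X.receiveVar P j ω ∂μ := fun j =>
    integral_sum_mul_of_indep (hX.inputSigma_le _) (hX.inputSigma_le _) hX.indep_rd_sr hU
      (fun m => hX.hasMoments_matchedCoef m j) (hX.hasMoments_receiveVar j) ha
  simp only [h]
  rw [Finset.sum_comm]
  simp only [← Finset.mul_sum, hX.sum_integral_matchedCoef]
  push_cast
  rfl

/-- The weights are here the conjugate entries of one row of `GRD`, uncorrelated with variances
`βRD`; hence the result does not depend on the antenna. -/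
theorem integral_relayPower (hX : IsRelayModel μ P X) (a : Antenna M₀ M₁) :
    ∫ ω, (X.relayPower P a ω : ℂ) ∂μ = (P.entryPower M₀ M₁ : ℂ) := by
  simp only [relayPower_cast]
  rw [integral_finsetSum _ fun j _ => (((hX.hasMoments_relayCoef a j).mul
    (hX.hasMoments_relayCoef a j).star).mul
      ((hX.hasMoments_receiveVar j).mono X.inputSigma_srLabels_le)).integrable,
    ← P.sum_βRD_mul_matchedPower]
  refine hX.sum_integral_combination (fun m => (hX.hasMoments_GRD a m).star) fun m n => ?_
  have := hX.isGaussianMatrix_GRD.integral_entry_mul_star a a n m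
  simp only [star_star, mul_comm (star _)]
  rw [this]
  by_cases h : m = n
  · subst h
    simp
  · simp [h, Ne.symm h]

theorem memLp_xRq (hX : IsRelayModel μ P X) (a : Antenna M₀ M₁) :
    MemLp (fun ω => X.xRq P ω a) 2 μ := by
  simp only [xRq_eq_sum]
  exact hX.isCondOrthogonal_all.memLp_sum hX.channelSigma_le (hX.hasMoments_transmitCoef a)

/-- A low-resolution DAC keeps α² of the power and adds αρ of it as noise, α in total; this is why
the gain appears to the first power. -/
theorem integral_norm_xRq_sq (hX : IsRelayModel μ P X) (a : Antenna M₀ M₁) :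
    ∫ ω, ‖X.xRq P ω a‖ ^ 2 ∂μ = P.gain M₀ M₁ a * P.entryPower M₀ M₁ := by
  have hq : ∀ b : Fin M₁, ∫ ω, (if a = Sum.inr b then (1 : ℂ) else 0) *
      star (if a = Sum.inr b then (1 : ℂ) else 0) *
        (((1 - P.ρ) * P.ρ * X.relayPower P (Sum.inr b) ω : ℝ) : ℂ) ∂μ =
      if a = Sum.inr b then (((1 - P.ρ) * P.ρ * P.entryPower M₀ M₁ : ℝ) : ℂ) else 0 := by
    intro b
    split_ifs with h
    · simp only [star_one, one_mul, Complex.ofReal_mul ((1 - P.ρ) * P.ρ)]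
      rw [integral_const_mul, hX.integral_relayPower]
    · simp
  have hr : ∑ j, ∫ ω, ((P.gain M₀ M₁ a : ℂ) * X.relayCoef P a j ω) *
      star ((P.gain M₀ M₁ a : ℂ) * X.relayCoef P a j ω) * X.receiveVar P j ω ∂μ =
      ((P.gain M₀ M₁ a ^ 2 * P.entryPower M₀ M₁ : ℝ) : ℂ) := by
    rw [Complex.ofReal_mul, ← hX.integral_relayPower a]
    simp only [relayPower_cast]
    rw [integral_finsetSum _ fun j _ => (((hX.hasMoments_relayCoef a j).mul
      (hX.hasMoments_relayCoef a j).star).mul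
      ((hX.hasMoments_receiveVar j).mono X.inputSigma_srLabels_le)).integrable, Finset.mul_sum]
    refine Finset.sum_congr rfl fun j _ => ?_
    rw [← integral_const_mul]
    refine integral_congr_ae (Filter.Eventually.of_forall fun ω => ?_)
    simp only [star_mul', Complex.star_def, Complex.conj_ofReal]
    push_cast
    ring
  have h : ∫ ω, X.xRq P ω a * star (X.xRq P ω a) ∂μ =
      ((P.gain M₀ M₁ a * P.entryPower M₀ M₁ : ℝ) : ℂ) := by
    simp only [xRq_eq_sum]
    rw [hX.isCondOrthogonal_all.integral_sum_mul_star_sum hX.channelSigma_le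
      (hX.hasMoments_transmitCoef a) (hX.hasMoments_transmitCoef a),
      Fintype.sum_sum_type (α₁ := ReceiveIndex K M₀ M₁)]
    simp only [transmitCoef, allVar, Sum.elim_inl, Sum.elim_inr, hq, hr]
    rcases a with a | a
    · simp [RelayParams.gain]
    · simp only [Sum.inr.injEq, Finset.sum_ite_eq, Finset.mem_univ, if_true,
        ← Complex.ofReal_add, RelayParams.gain, Sum.elim_inr, RelayParams.α]
      congr 1
      ring
  rw [integral_mul_star_eq] at h
  exact_mod_cast h

theorem integral_sum_norm_xRq_sq (hX : IsRelayModel μ P X) :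
    ∫ ω, ∑ a, ‖X.xRq P ω a‖ ^ 2 ∂μ = P.entryPower M₀ M₁ * P.N₁ M₀ M₁ := by
  rw [integral_finsetSum _ fun a _ =>
    (memLp_two_iff_integrable_sq_norm (hX.memLp_xRq a).1).1 (hX.memLp_xRq a)]
  simp only [hX.integral_norm_xRq_sq]
  rw [← Finset.sum_mul, P.sum_gain, mul_comm]

end IsRelayModel

end

/-! ### Desired signal, effective noise and rate. -/

noncomputable section

namespace IsRelayModel

open RelaySignals

variable {Ω : Type*} [mΩ : MeasurableSpace Ω] {μ : Measure Ω} {K M₀ M₁ : ℕ}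
  {P : RelayParams K} {X : RelaySignals Ω K M₀ M₁}

/-- The deterministic amplitude of the symbol in the desired signal. -/
def desiredGain (X : RelaySignals Ω K M₀ M₁) (P : RelayParams K) (μ : Measure Ω) (k : Fin K) : ℝ :=
  Real.sqrt (P.pS k) * (X.γ P μ * P.N₁ M₀ M₁ ^ 2 * P.βSR k * P.βRD k)

theorem desiredGain_sq (k : Fin K) :
    desiredGain X P μ k ^ 2 = P.termA M₀ M₁ (X.γ P μ) k := by
  rw [desiredGain, mul_pow, Real.sq_sqrt (P.pS_nonneg k), RelayParams.termA]
  ring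

variable [IsProbabilityMeasure μ]

theorem γ_eq (hX : IsRelayModel μ P X) :
    X.γ P μ = Real.sqrt (P.pR / (P.entryPower M₀ M₁ * P.N₁ M₀ M₁)) := by
  rw [γ, hX.integral_sum_norm_xRq_sq]

theorem integral_transmit_power (hX : IsRelayModel μ P X) (hM : 0 < M₀ + M₁) (k : Fin K) :
    ∫ ω, ∑ a, ‖(X.γ P μ : ℂ) * X.xRq P ω a‖ ^ 2 ∂μ = P.pR := by
  have hpos : 0 < P.entryPower M₀ M₁ * P.N₁ M₀ M₁ :=
    mul_pos (P.entryPower_pos hM k) (P.N₁_pos hM)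
  simp only [norm_mul, mul_pow, ← Finset.mul_sum]
  rw [integral_const_mul, hX.integral_sum_norm_xRq_sq, hX.γ_eq, Complex.norm_real,
    Real.norm_eq_abs, sq_abs, Real.sq_sqrt (div_nonneg P.pR_nonneg hpos.le),
    div_mul_cancel₀ _ hpos.ne']

theorem memLp_yD (hX : IsRelayModel μ P X) (k : Fin K) : MemLp (X.yD P μ k) 2 μ := by
  have : X.yD P μ k = fun ω => ∑ j, X.destCoef P (X.γ P μ) k j ω * X.allSignal j ω :=
    funext fun ω => X.yD_eq_sum P μ k ω
  rw [this]
  exact hX.isCondOrthogonal_all.memLp_sum hX.channelSigma_le (hX.hasMoments_destCoef _ k)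

/-- The hops are independent and each mean Gram matrix is diagonal, so only m = k contributes, with
one factor N₁ per hop. -/
theorem integral_T (hX : IsRelayModel μ P X) (k : Fin K) :
    ∫ ω, X.T P μ k k ω ∂μ =
      ((X.γ P μ * P.N₁ M₀ M₁ ^ 2 * P.βSR k * P.βRD k : ℝ) : ℂ) := by
  have hu := fun m => hasMoments_weightedGram hX.hasMoments_GRD (P.gain M₀ M₁) k m
  have hw := fun m => hasMoments_weightedGram hX.hasMoments_GSR (P.gain M₀ M₁) k m
  simp only [T_eq_sum]
  rw [integral_const_mul, integral_finsetSum _ fun m _ =>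
    (((hu m).mono (hX.inputSigma_le _)).mul ((hw m).mono (hX.inputSigma_le _))).integrable]
  have h : ∀ m, ∫ ω, weightedGram (P.gain M₀ M₁) X.GRD k m ω *
      weightedGram (P.gain M₀ M₁) X.GSR k m ω ∂μ =
      if k = m then ((P.N₁ M₀ M₁ ^ 2 * P.βSR k * P.βRD k : ℝ) : ℂ) else 0 := by
    intro m
    rw [(hu m).integral_mul_of_indep (hX.inputSigma_le _) (hX.inputSigma_le _) hX.indep_rd_sr
      (hw m), hX.isGaussianMatrix_GRD.integral_weightedGram,
      hX.isGaussianMatrix_GSR.integral_weightedGram, P.sum_gain]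
    split_ifs
    · rw [← Complex.ofReal_mul]
      congr 1
      ring
    · rw [zero_mul]
  simp only [h, Finset.sum_ite_eq, Finset.mem_univ, if_true]
  rw [← Complex.ofReal_mul]
  congr 1
  ring

theorem desired_eq_sum (hX : IsRelayModel μ P X) (k : Fin K) (ω : Ω) :
    X.desired P μ k ω =
      ∑ j, (if j = symbolIndex k then (desiredGain X P μ k : ℂ) else 0) * X.allSignal j ω := by
  simp only [ite_mul, zero_mul, Finset.sum_ite_eq', Finset.mem_univ, if_true]
  rw [desired, hX.integral_T, desiredGain, ← Complex.ofReal_mul]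
  rfl

/-- The symbol reaches its destination with coefficient √p times the end-to-end channel. That its
mean is the desired amplitude is what makes the effective noise uncorrelated with the desired
signal. -/
theorem integral_destCoef_symbolIndex (hX : IsRelayModel μ P X) (k : Fin K) :
    ∫ ω, X.destCoef P (X.γ P μ) k (symbolIndex k) ω ∂μ = (desiredGain X P μ k : ℂ) := by
  have h : ∀ ω, X.destCoef P (X.γ P μ) k (symbolIndex k) ω =
      (Real.sqrt (P.pS k) : ℂ) * X.T P μ k k ω := by
    intro ω
    have hne : (Sum.inl (Sum.inl k) : ReceiveIndex K M₀ M₁) ≠ destNoiseIndex k := by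
      simp [destNoiseIndex]
    simp only [symbolIndex, destCoef, matchedCoef, T_eq_sum, if_neg hne, add_zero, Finset.mul_sum]
    exact Finset.sum_congr rfl fun m _ => by ring
  simp only [h]
  rw [integral_const_mul, hX.integral_T, ← Complex.ofReal_mul, desiredGain]

theorem hasMoments_desiredCoef (k : Fin K) (j : ReceiveIndex K M₀ M₁ ⊕ Fin M₁) :
    HasMoments X.channelSigma μ
      fun _ => if j = symbolIndex k then (desiredGain X P μ k : ℂ) else 0 :=
  HasMoments.const _

theorem memLp_desired (hX : IsRelayModel μ P X) (k : Fin K) : MemLp (X.desired P μ k) 2 μ := by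
  rw [funext (hX.desired_eq_sum k)]
  exact hX.isCondOrthogonal_all.memLp_sum hX.channelSigma_le (hasMoments_desiredCoef k)

/-- The desired signal involves one member of the orthogonal family, with deterministic amplitude
and conditional power one, so only the mean of the matching coefficient is seen. -/
theorem integral_desired_mul_star_sum (hX : IsRelayModel μ P X) (k : Fin K)
    {d : ReceiveIndex K M₀ M₁ ⊕ Fin M₁ → Ω → ℂ} (hd : ∀ j, HasMoments X.channelSigma μ (d j)) :
    ∫ ω, X.desired P μ k ω * star (∑ j, d j ω * X.allSignal j ω) ∂μ =
      desiredGain X P μ k * star (∫ ω, d (symbolIndex k) ω ∂μ) := by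
  simp only [hX.desired_eq_sum k]
  rw [hX.isCondOrthogonal_all.integral_sum_mul_star_sum hX.channelSigma_le
    (hasMoments_desiredCoef k) hd, Finset.sum_eq_single (symbolIndex k)]
  · have h1 : ∀ ω, (X.allVar P (symbolIndex k) ω : ℂ) = 1 := fun ω => Complex.ofReal_one
    simp only [if_true, h1, mul_one]
    rw [integral_const_mul]
    congr 1
    exact integral_conj
  · intro j _ hj
    simp [hj]
  · simp

theorem integral_desired_mul_star_yD (hX : IsRelayModel μ P X) (k : Fin K) :
    ∫ ω, X.desired P μ k ω * star (X.yD P μ k ω) ∂μ =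
      ((desiredGain X P μ k ^ 2 : ℝ) : ℂ) := by
  simp only [yD_eq_sum]
  rw [hX.integral_desired_mul_star_sum k (hX.hasMoments_destCoef _ k),
    hX.integral_destCoef_symbolIndex, Complex.star_def, Complex.conj_ofReal, sq,
    Complex.ofReal_mul]

theorem integral_desired_mul_star_desired (hX : IsRelayModel μ P X) (k : Fin K) :
    ∫ ω, X.desired P μ k ω * star (X.desired P μ k ω) ∂μ =
      ((desiredGain X P μ k ^ 2 : ℝ) : ℂ) := by
  have h := hX.integral_desired_mul_star_sum k
    (hasMoments_desiredCoef (P := P) (X := X) (μ := μ) k)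
  simp only [← hX.desired_eq_sum k, if_true, integral_const, probReal_univ, one_smul] at h
  rw [h, Complex.star_def, Complex.conj_ofReal, sq, Complex.ofReal_mul]

theorem integral_desired_mul_star_effNoise (hX : IsRelayModel μ P X) (k : Fin K) :
    ∫ ω, X.desired P μ k ω * star (X.effNoise P μ k ω) ∂μ = 0 := by
  simp only [effNoise, star_sub, mul_sub]
  rw [integral_sub (integrable_mul_star (hX.memLp_desired k) (hX.memLp_yD k))
    (integrable_mul_star (hX.memLp_desired k) (hX.memLp_desired k)),
    hX.integral_desired_mul_star_yD, hX.integral_desired_mul_star_desired, sub_self]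

theorem memLp_effNoise (hX : IsRelayModel μ P X) (k : Fin K) : MemLp (X.effNoise P μ k) 2 μ :=
  (hX.memLp_yD k).sub (hX.memLp_desired k)

/-- The power of the signal received by destination `k`. -/
theorem integral_yD_mul_star (hX : IsRelayModel μ P X) (k : Fin K) :
    ∫ ω, X.yD P μ k ω * star (X.yD P μ k ω) ∂μ =
      ((X.γ P μ ^ 2 * (∑ m, (P.N₂ M₀ M₁ * P.βRD k * P.βRD m +
        if k = m then P.N₁ M₀ M₁ ^ 2 * P.βRD k ^ 2 else 0) * P.matchedPower M₀ M₁ m +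
      (1 - P.ρ) * P.ρ * M₁ * ∑ m, (P.βRD k * P.βRD m + if k = m then P.βRD k ^ 2 else 0) *
        P.matchedPower M₀ M₁ m) + 1 : ℝ) : ℂ) := by
  obtain ⟨g, hg⟩ : ∃ g, g = X.γ P μ := ⟨_, rfl⟩
  simp only [yD_eq_sum]
  rw [hX.isCondOrthogonal_all.integral_sum_mul_star_sum hX.channelSigma_le
    (hX.hasMoments_destCoef _ k) (hX.hasMoments_destCoef _ k),
    Fintype.sum_sum_type (α₁ := ReceiveIndex K M₀ M₁), ← hg]
  have hcomb := hX.sum_integral_combination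
    (fun m => hasMoments_weightedGram hX.hasMoments_GRD (P.gain M₀ M₁) k m)
    (a := fun m => P.N₂ M₀ M₁ * P.βRD k * P.βRD m +
      if k = m then P.N₁ M₀ M₁ ^ 2 * P.βRD k ^ 2 else 0) fun m n => by
        rw [hX.isGaussianMatrix_GRD.integral_weightedGram_mul_star, P.sum_gain_sq, P.sum_gain]
  have hrecv : ∀ j, ∫ ω, X.destCoef P g k (Sum.inl j) ω * star (X.destCoef P g k (Sum.inl j) ω) *
      X.allVar P (Sum.inl j) ω ∂μ =
      (g : ℂ) ^ 2 * (∫ ω, (∑ m, weightedGram (P.gain M₀ M₁) X.GRD k m ω * X.matchedCoef P m j ω) *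
        star (∑ m, weightedGram (P.gain M₀ M₁) X.GRD k m ω * X.matchedCoef P m j ω) *
        X.receiveVar P j ω ∂μ) + if j = destNoiseIndex k then 1 else 0 := by
    intro j
    by_cases hj : j = destNoiseIndex k
    · subst hj
      simp [destCoef, destNoiseIndex, matchedCoef, allVar, receiveVar]
    · rw [if_neg hj, add_zero, ← integral_const_mul]
      refine integral_congr_ae (Filter.Eventually.of_forall fun ω => ?_)
      simp only [destCoef, if_neg hj, add_zero, allVar, Sum.elim_inl]
      rw [star_mul', Complex.star_def, Complex.conj_ofReal]
      ring
  -- The DAC noise on antenna b has a variance that depends on the same row of `GRD` as its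
  -- coefficient. Absorbing that coefficient into `relayCoef` gives weights G_bk times the conjugate
  -- of G_bm, still functions of `GRD` alone and uncorrelated in m.
  have hdac : ∀ b, ∫ ω, X.destCoef P g k (Sum.inr b) ω * star (X.destCoef P g k (Sum.inr b) ω) *
      X.allVar P (Sum.inr b) ω ∂μ =
      (g : ℂ) ^ 2 * (((1 - P.ρ) * P.ρ *
        ∑ m, (P.βRD k * P.βRD m + if k = m then P.βRD k ^ 2 else 0) *
          P.matchedPower M₀ M₁ m : ℝ) : ℂ) := by
    intro b
    have hG := hX.hasMoments_GRD
    have hb := hX.sum_integral_combination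
      (fun m => (hG (Sum.inr b) k).mul (hG (Sum.inr b) m).star)
      (a := fun m => P.βRD k * P.βRD m + if k = m then P.βRD k ^ 2 else 0) fun m n => by
        have h4 := hX.isGaussianMatrix_GRD.integral_four_entries (Sum.inr b) (Sum.inr b)
          (Sum.inr b) (Sum.inr b) k m n k
        have heq : ∀ ω, X.GRD ω (Sum.inr b) k * star (X.GRD ω (Sum.inr b) m) *
            star (X.GRD ω (Sum.inr b) k * star (X.GRD ω (Sum.inr b) n)) =
            X.GRD ω (Sum.inr b) k * star (X.GRD ω (Sum.inr b) m) * X.GRD ω (Sum.inr b) n *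
              star (X.GRD ω (Sum.inr b) k) := by
          intro ω
          rw [star_mul', star_star]
          ring
        simp only [heq, h4, true_and]
        by_cases hmn : m = n
        · subst hmn
          by_cases hk : k = m
          · subst hk
            simp
            ring
          · simp [hk]
        · have h1 : ¬(k = m ∧ n = k) := fun H => hmn (H.1.symm.trans H.2.symm)
          simp [hmn, h1, Ne.symm hmn]
    rw [Complex.ofReal_mul, ← hb, ← integral_finsetSum, ← integral_const_mul, ← integral_const_mul]
    · refine integral_congr_ae (Filter.Eventually.of_forall fun ω => ?_)
      have hr : (X.GRD ω (Sum.inr b) k * star (X.GRD ω (Sum.inr b) k)) *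
          (X.relayPower P (Sum.inr b) ω : ℂ) = ∑ j,
          (∑ m, X.GRD ω (Sum.inr b) k * star (X.GRD ω (Sum.inr b) m) * X.matchedCoef P m j ω) *
          star (∑ m, X.GRD ω (Sum.inr b) k * star (X.GRD ω (Sum.inr b) m) *
            X.matchedCoef P m j ω) * X.receiveVar P j ω := by
        rw [relayPower_cast, Finset.mul_sum]
        refine Finset.sum_congr rfl fun j _ => ?_
        simp only [mul_assoc (X.GRD ω (Sum.inr b) k), ← Finset.mul_sum]
        rw [star_mul', relayCoef]
        ring
      simp only [← hr, destCoef, allVar, Sum.elim_inr]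
      rw [star_mul', Complex.star_def, Complex.conj_ofReal]
      push_cast
      ring
    · refine fun j _ => HasMoments.integrable (m := X.channelSigma) ?_
      have hc : HasMoments X.channelSigma μ fun ω =>
          ∑ m, X.GRD ω (Sum.inr b) k * star (X.GRD ω (Sum.inr b) m) * X.matchedCoef P m j ω :=
        HasMoments.sum _ fun m =>
          (((hG (Sum.inr b) k).mul (hG (Sum.inr b) m).star).mono X.inputSigma_rdLabels_le).mul
            ((hX.hasMoments_matchedCoef m j).mono X.inputSigma_srLabels_le)
      exact (hc.mul hc.star).mul ((hX.hasMoments_receiveVar j).mono X.inputSigma_srLabels_le)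
  simp only [hrecv, hdac, Finset.sum_add_distrib, ← Finset.mul_sum, hcomb, Finset.sum_ite_eq',
    Finset.mem_univ, if_true, Finset.sum_const, Finset.card_univ, Fintype.card_fin, nsmul_eq_mul]
  push_cast
  ring

theorem integral_norm_desired_sq (hX : IsRelayModel μ P X) (k : Fin K) :
    ∫ ω, ‖X.desired P μ k ω‖ ^ 2 ∂μ = P.termA M₀ M₁ (X.γ P μ) k := by
  have h := hX.integral_desired_mul_star_desired k
  rw [integral_mul_star_eq, desiredGain_sq] at h
  exact_mod_cast h

theorem integral_norm_effNoise_sq (hX : IsRelayModel μ P X) (k : Fin K) :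
    ∫ ω, ‖X.effNoise P μ k ω‖ ^ 2 ∂μ =
      P.termB M₀ M₁ (X.γ P μ) k + P.termC M₀ M₁ (X.γ P μ) k + P.termD M₀ M₁ (X.γ P μ) k +
        P.termE M₀ M₁ (X.γ P μ) k + P.termF M₀ M₁ (X.γ P μ) k +
        P.termG M₀ M₁ (X.γ P μ) k + 1 := by
  have hs := hX.memLp_desired k
  have hn := hX.memLp_effNoise k
  -- Splits the received power so that the middle term has mean zero and the first has mean A; the
  -- noise power then follows by cancellation, without expanding the effective noise itself.
  have hy : ∀ ω, X.yD P μ k ω * star (X.yD P μ k ω) =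
      X.yD P μ k ω * star (X.desired P μ k ω) + (X.desired P μ k ω * star (X.effNoise P μ k ω) +
        X.effNoise P μ k ω * star (X.effNoise P μ k ω)) := by
    intro ω
    simp only [effNoise, star_sub]
    ring
  have hys : ∫ ω, X.yD P μ k ω * star (X.desired P μ k ω) ∂μ =
      (P.termA M₀ M₁ (X.γ P μ) k : ℂ) := by
    have h := integral_conj (𝕜 := ℂ) (μ := μ)
      (f := fun ω => X.desired P μ k ω * star (X.yD P μ k ω))
    rw [hX.integral_desired_mul_star_yD, desiredGain_sq, Complex.conj_ofReal] at h
    rw [← h]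
    refine integral_congr_ae (Filter.Eventually.of_forall fun ω => ?_)
    simp [mul_comm]
  have h := hX.integral_yD_mul_star k
  simp only [hy] at h
  have hint : Integrable (fun ω => X.desired P μ k ω * star (X.effNoise P μ k ω) +
      X.effNoise P μ k ω * star (X.effNoise P μ k ω)) μ :=
    (integrable_mul_star hs hn).add (integrable_mul_star hn hn)
  rw [integral_add (integrable_mul_star (hX.memLp_yD k) hs) hint,
    integral_add (integrable_mul_star hs hn) (integrable_mul_star hn hn),
    hX.integral_desired_mul_star_effNoise, zero_add, hys, integral_mul_star_eq,
    P.received_power_eq, ← Complex.ofReal_add] at h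
  exact add_left_cancel (Complex.ofReal_injective h)

end IsRelayModel

end

theorem theorem1 {Ω : Type*} [MeasurableSpace Ω] (μ : Measure Ω) [IsProbabilityMeasure μ]
    {K M₀ M₁ : ℕ} (hM : 0 < M₀ + M₁) (P : RelayParams K) (X : RelaySignals Ω K M₀ M₁)
    (hX : IsRelayModel μ P X) (k : Fin K) :
    -- the relay meets its power constraint
    (∫ ω, ∑ a, ‖(X.γ P μ : ℂ) * X.xRq P ω a‖ ^ 2 ∂μ = P.pR) ∧
    -- the normalization factor in closed form
    X.γ P μ = Real.sqrt (P.pR / (P.entryPower M₀ M₁ * P.N₁ M₀ M₁)) ∧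
    -- the desired signal and the effective noise have finite power and are uncorrelated
    MemLp (X.desired P μ k) 2 μ ∧ MemLp (X.effNoise P μ k) 2 μ ∧
    (∫ ω, X.desired P μ k ω * star (X.effNoise P μ k ω) ∂μ = 0) ∧
    -- the achievable rate in closed form
    X.rate P μ k =
      ((P.τc : ℝ) - 2 * P.τp) / (2 * P.τc) *
        Real.logb 2 (1 + P.termA M₀ M₁ (X.γ P μ) k /
          (P.termB M₀ M₁ (X.γ P μ) k + P.termC M₀ M₁ (X.γ P μ) k + P.termD M₀ M₁ (X.γ P μ) k +
            P.termE M₀ M₁ (X.γ P μ) k + P.termF M₀ M₁ (X.γ P μ) k +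
            P.termG M₀ M₁ (X.γ P μ) k + 1)) := by
  refine ⟨hX.integral_transmit_power hM k, hX.γ_eq, hX.memLp_desired k, hX.memLp_effNoise k,
    hX.integral_desired_mul_star_effNoise k, ?_⟩
  rw [RelaySignals.rate, hX.integral_norm_desired_sq, hX.integral_norm_effNoise_sq]
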